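/- Let $d,q\in\mathbb N$ and let $\mathcal A$ be the quasi-local $C^*$-algebra of countably many $d$-level particles, i.e. the norm closure of the local algebras generated by the operators $x^{(k)}$ ($x\in M_d(\mathbb C)$ acting on particle $k\in\mathbb N$). Fix a basis $v_1,\dots,v_{d^2}$ of $M_d(\mathbb C)$ with $v_\alpha=v_\alpha^\dagger$ and $\operatorname{tr}(v_\alpha v_\beta)=\delta_{\alpha\beta}$, put $m_\alpha^N=\frac1N\sum_{k=1}^N v_\alpha^{(k)}$, and consider for every $N$ the Lindblad generator (acting on observables) $$\mathcal L_N[O]=i[H,O]+\sum_{\ell=1}^q\frac12\sum_{k=1}^N\Big([J_\ell^{k\dagger},O]J_\ell^k+J_\ell^{k\dagger}[O,J_\ell^k]\Big),\qquad J_\ell^k=j_\ell^{(k)}\,\Gamma_\ell(\Delta_N^\ell),$$ $$H=\sum_{k=1}^N\sum_\alpha\epsilon_\alpha v_\alpha^{(k)}+\frac1N\sum_{k,j=1}^N\sum_{\alpha,\beta}h_{\alpha\beta}v_\alpha^{(k)}v_\beta^{(j)},\qquad \Delta_N^\ell=\sum_\alpha r_{\ell\alpha}m_\alpha^N,$$ with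 $\epsilon_\alpha,r_{\ell\alpha}\in\mathbb R$, $h_{\alpha\beta}=\overline{h_{\beta\alpha}}$, $j_\ell\in M_d(\mathbb C)$, and $\Gamma_\ell(z)=\sum_{n\ge0}c_\ell^n z^n$ with real coefficients and $\sum_n|c_\ell^n||z|^n<\infty$ for all $z\in\mathbb R$. Let $$f_\alpha(m)=i\sum_\beta A_{\alpha\beta}m_\beta+i\sum_{\beta,\gamma}B_{\alpha\beta\gamma}m_\beta m_\gamma+\sum_{\ell,\beta}M_{\ell\alpha}^\beta\,\Gamma_\ell\Big(\sum_\mu r_{\ell\mu}m_\mu\Big)^2 m_\beta ,$$ where $a_{\alpha\beta}^\gamma=\operatorname{tr}([v_\alpha,v_\beta]v_\gamma)$, $A_{\alpha\beta}=\sum_{\beta'}\epsilon_{\beta'}a_{\beta'\alpha}^\beta$, $B_{\alpha\beta\gamma}=\sum_{\beta'}a_{\beta'\alpha}^\gamma(h_{\beta\beta'}+h_{\beta'\beta})$ and $\frac12\big([j_\ell^\dagger,v_\alpha]j_\ell+j_\ell^\dagger[v_\alpha,j_\ell]\big)=\sum_\beta M_{\ell\alpha}^\beta v_\beta$. Then there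 are constants $C_1,C_2>0$, depending only on these data (not on $N$, on time or on the state), such that the following holds for every state $\omega$ on $\mathcal A$ for which the limits $m_\alpha(0)=\lim_{N\to\infty}\omega(m_\alpha^N)$ exist (for instance every translation-invariant state). The mean-field equations $\frac{d}{dt}m_\alpha=f_\alpha(m)$ with this initial condition have a unique real solution $m(t)$ on $[0,\infty)$, and with $\omega_t=\omega\circ e^{t\mathcal L_N}$ and $\mathcal E_N(t)=\sum_\alpha\omega_t\big([m_\alpha^N-m_\alpha(t)]^2\big)$ one has $$\mathcal E_N(t)\le e^{C_1t}\mathcal E_N(0)+\frac{C_2\,(e^{C_1t}-1)}{C_1N}\qquad\text{for all }N\ge1,\ t\ge0 .$$ Moreover, if $\lim_{N\to\infty}\mathcal E_N(0)=0$ (for instance if $\omega$ is a translation-invariant clustering state), then for every $0\le t<\infty$ $$\lim_{N\to\infty}\mathcal E_N(t)=0\qquad\text{and}\qquad \lim_{N\to\infty}\omega_t(m_\alpha^N)=m_\alpha(t)\quad\text{for all }\alpha .$$ -/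

import Mathlib

open scoped ComplexConjugate

noncomputable section

namespace MeanField

/-! ### The quasi-local algebra of countably many `d`-level systems

The local algebras `M_d ⊗ ⋯ ⊗ M_d` are represented faithfully on `ℓ²` of the set of all
configurations `ℕ → Fin d`; the matrix `x` at site `k` acts on the `k`-th entry only. -/

/-- The Hilbert space `ℓ²` over the configurations `ℕ → Fin d`. -/
abbrev ConfigSpace (d : ℕ) : Type := lp (fun _ : ℕ → Fin d => ℂ) 2

/-- Action of `x` on the `k`-th entry:
`(x⁽ᵏ⁾ ψ)(s) = ∑_b x_{s_k, b} ψ(s with k-th entry replaced by b)`. -/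
def siteFun {d : ℕ} (k : ℕ) (x : Matrix (Fin d) (Fin d) ℂ) (f : (ℕ → Fin d) → ℂ) :
    (ℕ → Fin d) → ℂ :=
  fun s => ∑ b, x (s k) b * f (Function.update s k b)

/-- The permutation of configurations that swaps the values `a` and `b` at site `k`. -/
def swapAt {d : ℕ} (k : ℕ) (a b : Fin d) : (ℕ → Fin d) ≃ (ℕ → Fin d) where
  toFun s := Function.update s k (Equiv.swap a b (s k))
  invFun s := Function.update s k (Equiv.swap a b (s k))
  left_inv s := by simp
  right_inv s := by simp

lemma summable_sq {d : ℕ} (f : ConfigSpace d) : Summable fun s => ‖f s‖ ^ 2 := by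
  have := (lp.memℓp f).summable (by norm_num)
  simpa using this

lemma tsum_sq {d : ℕ} (f : ConfigSpace d) : ∑' s, ‖f s‖ ^ 2 = ‖f‖ ^ 2 := by
  have := lp.norm_rpow_eq_tsum (p := 2) (by norm_num) f
  simpa using this.symm

/-- A bound on the square of the norm of the operator at one site. -/
def siteBound {d : ℕ} (x : Matrix (Fin d) (Fin d) ℂ) : ℝ := ∑ a, ∑ b, ‖x a b‖ ^ 2

lemma siteFun_le {d : ℕ} (k : ℕ) (x : Matrix (Fin d) (Fin d) ℂ) (f : (ℕ → Fin d) → ℂ)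
    (s : ℕ → Fin d) :
    ‖siteFun k x f s‖ ^ 2 ≤ siteBound x * ∑ a, ∑ b, ‖f (swapAt k a b s)‖ ^ 2 := by
  have h1 : ‖siteFun k x f s‖ ^ 2 ≤
      (∑ b, ‖x (s k) b‖ ^ 2) * ∑ b, ‖f (Function.update s k b)‖ ^ 2 := by
    calc ‖siteFun k x f s‖ ^ 2 ≤ (∑ b, ‖x (s k) b‖ * ‖f (Function.update s k b)‖) ^ 2 := by
          gcongr
          refine (norm_sum_le _ _).trans (le_of_eq ?_)
          simp
      _ ≤ _ := Finset.sum_mul_sq_le_sq_mul_sq _ _ _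
  refine h1.trans ?_
  have hs : ∀ b, swapAt k (s k) b s = Function.update s k b := by intro b; simp [swapAt]
  unfold siteBound
  refine mul_le_mul ?_ ?_ (by positivity) (by positivity)
  · exact Finset.single_le_sum (f := fun a => ∑ b, ‖x a b‖ ^ 2)
      (fun a _ => by positivity) (Finset.mem_univ (s k))
  · simp only [← hs]
    exact Finset.single_le_sum (f := fun a => ∑ b, ‖f (swapAt k a b s)‖ ^ 2)
      (fun a _ => by positivity) (Finset.mem_univ (s k))

lemma hasSum_swaps {d : ℕ} (k : ℕ) (f : ConfigSpace d) :
    HasSum (fun s => ∑ a : Fin d, ∑ b : Fin d, ‖f (swapAt k a b s)‖ ^ 2)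
      ((d : ℝ) * d * ‖f‖ ^ 2) := by
  have h : ∀ a b : Fin d, HasSum (fun s => ‖f (swapAt k a b s)‖ ^ 2) (‖f‖ ^ 2) := by
    intro a b
    have := (summable_sq f).hasSum
    rw [tsum_sq] at this
    exact (Equiv.hasSum_iff (swapAt k a b)).2 this
  have := hasSum_sum (s := Finset.univ) fun a (_ : a ∈ Finset.univ) =>
    hasSum_sum (s := Finset.univ) fun b (_ : b ∈ Finset.univ) => h a b
  simpa [mul_assoc] using this

lemma siteFun_memlp {d : ℕ} (k : ℕ) (x : Matrix (Fin d) (Fin d) ℂ) (f : ConfigSpace d) :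
    Memℓp (siteFun k x f) 2 := by
  apply memℓp_gen
  have h := ((hasSum_swaps k f).summable).mul_left (siteBound x)
  have := Summable.of_nonneg_of_le (fun s => by positivity) (siteFun_le k x f) h
  simpa using this

/-- `x` acting at site `k`, as a linear map on `ℓ²`. -/
def siteLin {d : ℕ} (k : ℕ) (x : Matrix (Fin d) (Fin d) ℂ) :
    ConfigSpace d →ₗ[ℂ] ConfigSpace d where
  toFun f := ⟨siteFun k x f, siteFun_memlp k x f⟩
  map_add' f g := by
    apply lp.ext
    funext s
    change siteFun k x (⇑f + ⇑g) s = siteFun k x f s + siteFun k x g s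
    simp [siteFun, mul_add, Finset.sum_add_distrib]
  map_smul' c f := by
    apply lp.ext
    funext s
    simp only [siteFun, lp.coeFn_smul, Pi.smul_apply, smul_eq_mul, RingHom.id_apply,
      Finset.mul_sum]
    exact Finset.sum_congr rfl fun b _ => by ring

/-- `x` acting at site `k`, as a bounded operator. -/
def siteCLM {d : ℕ} (k : ℕ) (x : Matrix (Fin d) (Fin d) ℂ) :
    ConfigSpace d →L[ℂ] ConfigSpace d :=
  (siteLin k x).mkContinuous (Real.sqrt (siteBound x * (d * d))) (by
    intro f
    have hb : 0 ≤ siteBound x := by unfold siteBound; positivity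
    rw [← abs_of_nonneg (norm_nonneg (siteLin k x f)), ← Real.sqrt_sq_eq_abs,
      ← Real.sqrt_sq (norm_nonneg f), ← Real.sqrt_mul (by positivity)]
    apply Real.sqrt_le_sqrt
    rw [← tsum_sq]
    have h := (hasSum_swaps k f).mul_left (siteBound x)
    have := (summable_sq (siteLin k x f)).tsum_le_tsum (siteFun_le k x f) h.summable
    rw [h.tsum_eq, ← mul_assoc] at this
    exact this)

@[simp] lemma siteCLM_apply {d : ℕ} (k : ℕ) (x : Matrix (Fin d) (Fin d) ℂ)
    (f : ConfigSpace d) (s : ℕ → Fin d) :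
    siteCLM k x f s = ∑ b, x (s k) b * f (Function.update s k b) := rfl

/-- Auxiliary summand for the computation of the adjoint. -/
def starAux {d : ℕ} (k : ℕ) (x : Matrix (Fin d) (Fin d) ℂ) (f g : ConfigSpace d) (a b : Fin d)
    (s : ℕ → Fin d) : ℂ :=
  if s k = a then conj (star x a b * f (swapAt k a b s)) * g s else 0

lemma summable_aux {d : ℕ} (k : ℕ) (x : Matrix (Fin d) (Fin d) ℂ) (f g : ConfigSpace d)
    (a b : Fin d) : Summable (starAux k x f g a b) := by
  have h1 : Summable fun s => ‖f (swapAt k a b s)‖ ^ 2 :=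
    (Equiv.summable_iff (swapAt k a b)).2 (summable_sq f)
  refine Summable.of_norm_bounded
    (((h1.add (summable_sq g)).mul_left (‖star x a b‖))) fun s => ?_
  unfold starAux
  split_ifs
  · rw [norm_mul, RCLike.norm_conj, norm_mul, mul_assoc]
    gcongr
    nlinarith [sq_nonneg (‖f (swapAt k a b s)‖ - ‖g s‖), norm_nonneg (f (swapAt k a b s)),
      norm_nonneg (g s)]
  · rw [norm_zero]; positivity

lemma inner_aux_left {d : ℕ} (k : ℕ) (x : Matrix (Fin d) (Fin d) ℂ) (f g : ConfigSpace d)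
    (s : ℕ → Fin d) :
    inner ℂ (siteCLM k (star x) f s) (g s) = ∑ a, ∑ b, starAux k x f g a b s := by
  rw [Finset.sum_eq_single (s k)]
  · rw [RCLike.inner_apply, siteCLM_apply, map_sum, Finset.mul_sum]
    refine Finset.sum_congr rfl fun b _ => ?_
    rw [starAux, if_pos rfl, mul_comm]
    simp [swapAt]
  · intro a _ ha
    exact Finset.sum_eq_zero fun b _ => if_neg (Ne.symm ha)
  · intro h; exact absurd (Finset.mem_univ _) h

lemma inner_aux_right {d : ℕ} (k : ℕ) (x : Matrix (Fin d) (Fin d) ℂ) (f g : ConfigSpace d)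
    (s : ℕ → Fin d) :
    inner ℂ (f s) (siteCLM k x g s) = ∑ a, ∑ b, starAux k x f g a b (swapAt k a b s) := by
  rw [Finset.sum_comm, Finset.sum_eq_single (s k)]
  · rw [RCLike.inner_apply, siteCLM_apply, Finset.sum_mul]
    refine Finset.sum_congr rfl fun a _ => ?_
    rw [starAux]
    simp [swapAt, Matrix.star_apply]
    ring
  · intro b _ hb
    refine Finset.sum_eq_zero fun a _ => ?_
    have : Equiv.swap a b (s k) ≠ a := by
      rw [Ne, Equiv.swap_apply_eq_iff, Equiv.swap_apply_left]; exact hb.symm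
    rw [starAux]
    exact if_neg (by simpa [swapAt] using this)
  · intro h; exact absurd (Finset.mem_univ _) h

lemma inner_site {d : ℕ} (k : ℕ) (x : Matrix (Fin d) (Fin d) ℂ) (f g : ConfigSpace d) :
    inner ℂ (siteCLM k (star x) f) g = inner ℂ f (siteCLM k x g) := by
  have h1 := hasSum_sum (s := Finset.univ) fun a (_ : a ∈ Finset.univ) =>
    hasSum_sum (s := Finset.univ) fun b (_ : b ∈ Finset.univ) => (summable_aux k x f g a b).hasSum
  have h2 := hasSum_sum (s := Finset.univ) fun a (_ : a ∈ Finset.univ) =>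
    hasSum_sum (s := Finset.univ) fun b (_ : b ∈ Finset.univ) =>
      (Equiv.hasSum_iff (swapAt k a b)).2 (summable_aux k x f g a b).hasSum
  have h3 := lp.hasSum_inner (𝕜 := ℂ) (siteCLM k (star x) f) g
  have h4 := lp.hasSum_inner (𝕜 := ℂ) f (siteCLM k x g)
  rw [funext (inner_aux_left k x f g)] at h3
  rw [funext (inner_aux_right k x f g)] at h4
  exact (h3.unique h1).trans (h4.unique h2).symm

lemma siteCLM_star {d : ℕ} (k : ℕ) (x : Matrix (Fin d) (Fin d) ℂ) :
    siteCLM k (star x) = star (siteCLM k x) := by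
  rw [ContinuousLinearMap.star_eq_adjoint, ContinuousLinearMap.eq_adjoint_iff]
  exact inner_site k x

/-- The embedding `x ↦ x⁽ᵏ⁾` of the one-particle algebra at site `k` as a unital
`*`-homomorphism into the bounded operators. -/
def siteHom {d : ℕ} (k : ℕ) :
    Matrix (Fin d) (Fin d) ℂ →⋆ₐ[ℂ] (ConfigSpace d →L[ℂ] ConfigSpace d) where
  toFun := siteCLM k
  map_one' := by
    ext f s
    simp [Matrix.one_apply]
  map_mul' x y := by
    ext f s
    simp only [siteCLM_apply, mul_apply_eq_comp, Function.update_self,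
      Function.update_idem, Matrix.mul_apply, Finset.mul_sum, Finset.sum_mul]
    rw [Finset.sum_comm]
    exact Finset.sum_congr rfl fun a _ => Finset.sum_congr rfl fun b _ => by ring
  map_zero' := by
    ext f s
    simp
  map_add' x y := by
    ext f s
    simp [add_mul, Finset.sum_add_distrib]
  commutes' c := by
    ext f s
    simp [Algebra.algebraMap_eq_smul_one, Matrix.one_apply]
  map_star' x := siteCLM_star k x

/-- Operators at different sites commute. -/
lemma siteHom_commute {d : ℕ} {k l : ℕ} (h : k ≠ l) (x y : Matrix (Fin d) (Fin d) ℂ) :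
    Commute (siteHom k x) (siteHom l y) := by
  change siteCLM k x * siteCLM l y = siteCLM l y * siteCLM k x
  ext f s
  simp only [siteCLM_apply, mul_apply_eq_comp, Finset.mul_sum,
    Function.update_of_ne h, Function.update_of_ne h.symm]
  rw [Finset.sum_comm]
  refine Finset.sum_congr rfl fun a _ => Finset.sum_congr rfl fun b _ => ?_
  rw [Function.update_comm h]; ring

/-- The strictly local operators: the `*`-algebra generated by all one-site operators. -/
def localAlgebra (d : ℕ) : StarSubalgebra ℂ (ConfigSpace d →L[ℂ] ConfigSpace d) :=
  StarAlgebra.adjoin ℂ (⋃ k : ℕ, Set.range (siteHom (d := d) k))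

/-- The quasi-local algebra as a `*`-subalgebra: the norm closure of the local operators. -/
def quasiLocalSubalgebra (d : ℕ) : StarSubalgebra ℂ (ConfigSpace d →L[ℂ] ConfigSpace d) :=
  (localAlgebra d).topologicalClosure

/-- The quasi-local `C⋆`-algebra. -/
def QuasiLocal (d : ℕ) : Type := quasiLocalSubalgebra d

instance (d : ℕ) : IsClosed (quasiLocalSubalgebra d :
    Set (ConfigSpace d →L[ℂ] ConfigSpace d)) :=
  StarSubalgebra.isClosed_topologicalClosure _

instance (d : ℕ) : CStarAlgebra (QuasiLocal d) :=
  inferInstanceAs (CStarAlgebra (quasiLocalSubalgebra d))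

lemma siteHom_mem {d : ℕ} (k : ℕ) (x : Matrix (Fin d) (Fin d) ℂ) :
    siteHom k x ∈ quasiLocalSubalgebra d :=
  (localAlgebra d).le_topologicalClosure
    (StarAlgebra.subset_adjoin ℂ _ (Set.mem_iUnion.2 ⟨k, x, rfl⟩))

/-- `x⁽ᵏ⁾`, the matrix `x` at site `k`, as an element of the quasi-local algebra. -/
def site {d : ℕ} (k : ℕ) : Matrix (Fin d) (Fin d) ℂ →⋆ₐ[ℂ] QuasiLocal d :=
  (siteHom k).codRestrict (quasiLocalSubalgebra d) (siteHom_mem k)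

lemma site_commute {d : ℕ} {k l : ℕ} (h : k ≠ l) (x y : Matrix (Fin d) (Fin d) ℂ) :
    Commute (site k x) (site l y) :=
  Subtype.ext (siteHom_commute h x y)

/-- The average operator `X_N = (1/N) ∑_k x⁽ᵏ⁾` of the first `N` particles. -/
def average {d : ℕ} (N : ℕ) (x : Matrix (Fin d) (Fin d) ℂ) : QuasiLocal d :=
  (N : ℂ)⁻¹ • ∑ k ∈ Finset.range N, site k x

/-- A state: a positive normalized linear functional on the quasi-local algebra. -/
structure QState (d : ℕ) where
  /-- The underlying functional. -/
  toLin : QuasiLocal d →ₗ[ℂ] ℂ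
  re_nonneg : ∀ a, 0 ≤ (toLin (star a * a)).re
  im_eq_zero : ∀ a, (toLin (star a * a)).im = 0
  map_one : toLin 1 = 1

/-! ### The model -/

/-- The parameters of the dynamics of `d`-level particles with `q` dissipators: a hermitian
orthonormal basis `v` of the matrices, Hamiltonian coefficients `ε`, `h`, one-site jump
matrices `j`, coefficients `r` of the collective operators, and the power series
coefficients `c` of the rate functions, with infinite radius of convergence. -/
structure Model (d q : ℕ) where
  v : Fin (d ^ 2) → Matrix (Fin d) (Fin d) ℂ
  v_herm : ∀ α, (v α).IsHermitian
  v_orth : ∀ α β, (v α * v β).trace = if α = β then 1 else 0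
  ε : Fin (d ^ 2) → ℝ
  h : Fin (d ^ 2) → Fin (d ^ 2) → ℂ
  h_herm : ∀ α β, h α β = conj (h β α)
  j : Fin q → Matrix (Fin d) (Fin d) ℂ
  r : Fin q → Fin (d ^ 2) → ℝ
  c : Fin q → ℕ → ℝ
  c_summable : ∀ ℓ, ∀ z : ℝ, Summable fun n => |c ℓ n| * |z| ^ n

namespace Model

variable {d q : ℕ} (P : Model d q)

/-- The basis of average operators `m_α^N`. -/
def mOp (N : ℕ) (α : Fin (d ^ 2)) : QuasiLocal d := average N (P.v α)

/-- The Hamiltonian of `N` particles, diagonal terms `k = j` of the double sum included. -/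
def hamiltonian (N : ℕ) : QuasiLocal d :=
  ∑ k ∈ Finset.range N, ∑ α, (P.ε α : ℂ) • site k (P.v α) +
  (N : ℂ)⁻¹ • ∑ k ∈ Finset.range N, ∑ j ∈ Finset.range N, ∑ α, ∑ β,
    P.h α β • (site k (P.v α) * site j (P.v β))

/-- The collective operator `Δ_N^ℓ`. -/
def deltaOp (N : ℕ) (ℓ : Fin q) : QuasiLocal d := ∑ α, (P.r ℓ α : ℂ) • P.mOp N α

/-- The operator-valued rate function `Γ_ℓ(Δ_N^ℓ)`. -/
def rateOp (N : ℕ) (ℓ : Fin q) : QuasiLocal d := ∑' n, (P.c ℓ n : ℂ) • P.deltaOp N ℓ ^ n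

/-- The scalar function `Γ_ℓ`. -/
def rate (ℓ : Fin q) (z : ℝ) : ℝ := ∑' n, P.c ℓ n * z ^ n

/-- The jump operators `J_ℓ^k = j_ℓ⁽ᵏ⁾ Γ_ℓ(Δ_N^ℓ)`. -/
def jump (N : ℕ) (ℓ : Fin q) (k : ℕ) : QuasiLocal d := site k (P.j ℓ) * P.rateOp N ℓ

/-- Left multiplication `O ↦ a O`. -/
abbrev mulL (a : QuasiLocal d) : QuasiLocal d →L[ℂ] QuasiLocal d :=
  ContinuousLinearMap.mul ℂ (QuasiLocal d) a

/-- Right multiplication `O ↦ O a`. -/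
abbrev mulR (a : QuasiLocal d) : QuasiLocal d →L[ℂ] QuasiLocal d :=
  (ContinuousLinearMap.mul ℂ (QuasiLocal d)).flip a

/-- The Lindblad generator in the Heisenberg picture, as a bounded operator on the
quasi-local algebra; see `lindblad_apply` for the explicit formula. -/
def lindblad (N : ℕ) : QuasiLocal d →L[ℂ] QuasiLocal d :=
  Complex.I • (mulL (P.hamiltonian N) - mulR (P.hamiltonian N)) +
  ∑ ℓ, (1 / 2 : ℂ) • ∑ k ∈ Finset.range N,
    (mulR (P.jump N ℓ k) ∘L (mulL (star (P.jump N ℓ k)) - mulR (star (P.jump N ℓ k))) +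
      mulL (star (P.jump N ℓ k)) ∘L (mulR (P.jump N ℓ k) - mulL (P.jump N ℓ k)))

/-- `𝓛_N[O] = i[H,O] + ∑_ℓ ½ ∑_k ([J†,O]J + J†[O,J])`. -/
lemma lindblad_apply (N : ℕ) (O : QuasiLocal d) :
    P.lindblad N O =
      Complex.I • (P.hamiltonian N * O - O * P.hamiltonian N) +
      ∑ ℓ, (1 / 2 : ℂ) • ∑ k ∈ Finset.range N,
        ((star (P.jump N ℓ k) * O - O * star (P.jump N ℓ k)) * P.jump N ℓ k +
          star (P.jump N ℓ k) * (O * P.jump N ℓ k - P.jump N ℓ k * O)) := by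
  simp [lindblad, mul_sub, sub_mul]

/-- The Heisenberg evolution `e^{t 𝓛_N}`. -/
def evolve (N : ℕ) (t : ℝ) : QuasiLocal d →L[ℂ] QuasiLocal d :=
  NormedSpace.exp ((t : ℂ) • P.lindblad N)

/-- `ω_t(O) = ω(e^{t 𝓛_N}[O])`. -/
def expect (ω : QState d) (N : ℕ) (t : ℝ) (O : QuasiLocal d) : ℂ :=
  ω.toLin (P.evolve N t O)

/-! ### The mean-field equations -/

/-- The structure coefficients `a_{αβ}^γ = tr([v_α, v_β] v_γ)`. -/
def structCoeff (α β γ : Fin (d ^ 2)) : ℂ :=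
  ((P.v α * P.v β - P.v β * P.v α) * P.v γ).trace

/-- `A_{αβ} = ∑_β' ε_β' a_{β'α}^β`. -/
def coeffA (α β : Fin (d ^ 2)) : ℂ := ∑ β', (P.ε β' : ℂ) * P.structCoeff β' α β

/-- `B_{αβγ} = ∑_β' a_{β'α}^γ (h_{ββ'} + h_{β'β})`. -/
def coeffB (α β γ : Fin (d ^ 2)) : ℂ :=
  ∑ β', P.structCoeff β' α γ * (P.h β β' + P.h β' β)

/-- The local dissipator at one site, `x ↦ ½([j†,x]j + j†[x,j])`. -/
def localDissipator (ℓ : Fin q) (x : Matrix (Fin d) (Fin d) ℂ) : Matrix (Fin d) (Fin d) ℂ :=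
  (1 / 2 : ℂ) • ((star (P.j ℓ) * x - x * star (P.j ℓ)) * P.j ℓ +
    star (P.j ℓ) * (x * P.j ℓ - P.j ℓ * x))

/-- `M_{ℓα}^β`, the coefficient of `v_β` in the local dissipator applied to `v_α`. -/
def coeffM (ℓ : Fin q) (α β : Fin (d ^ 2)) : ℂ :=
  (P.localDissipator ℓ (P.v α) * P.v β).trace

/-- `Δ_ℓ = ∑_α r_{ℓα} m_α`. -/
def delta (ℓ : Fin q) (m : Fin (d ^ 2) → ℝ) : ℝ := ∑ α, P.r ℓ α * m α

/-- The right-hand side `f_α` of the mean-field equations. -/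
def meanField (m : Fin (d ^ 2) → ℝ) (α : Fin (d ^ 2)) : ℂ :=
  Complex.I * ∑ β, P.coeffA α β * (m β : ℂ) +
  Complex.I * ∑ β, ∑ γ, P.coeffB α β γ * (m β : ℂ) * (m γ : ℂ) +
  ∑ ℓ, ∑ β, P.coeffM ℓ α β * ((P.rate ℓ (P.delta ℓ m) : ℝ) : ℂ) ^ 2 * (m β : ℂ)

/-- `m` solves `dm_α/dt = f_α(m)` on `[0, ∞)` with `m(0) = m₀`. -/
def IsMeanFieldSolution (m₀ : Fin (d ^ 2) → ℝ) (m : ℝ → Fin (d ^ 2) → ℝ) : Prop :=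
  m 0 = m₀ ∧ ∀ t, 0 ≤ t → ∀ α,
    HasDerivWithinAt (fun s => (m s α : ℂ)) (P.meanField (m t) α) (Set.Ici 0) t

/-- The total variance `𝓔_N(t) = ∑_α ω_t([m_α^N - m_α(t)]²)`. Each summand is the value of a
state at the square of a self-adjoint element, hence real. -/
def totalVariance (ω : QState d) (m : ℝ → Fin (d ^ 2) → ℝ) (N : ℕ) (t : ℝ) : ℝ :=
  (∑ α, P.expect ω N t ((P.mOp N α - algebraMap ℂ (QuasiLocal d) (m t α)) ^ 2)).re

end Model

end MeanField

end

open scoped ComplexConjugate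

noncomputable section

namespace MeanField

open Filter Topology Set Asymptotics
open scoped ComplexOrder NNReal

/-! The total variance `E` satisfies `E' ≤ C (E + 1/N)` with `C` independent of `N`, the time and
the state; Grönwall's inequality then gives everything else.

Put `X = m_α^N - m_α(t)`, `Y = 𝓛_N[m_α^N] - f_α(m(t))`. The derivative of `ω_t(X²)` is `ω_t(𝓛_N[X²]
- 2 f_α X)`, and by `lindbladOf_sq` the operator inside equals `YX + XY + D`, where `D = ∑
[X,J]†[X,J]` measures the failure of the Leibniz rule. `D` has `qN` terms of norm `O(N⁻²)`
(`small_sum_lie_jump`), so the point is `ω_t(Y²) = O(E + 1/N)`, which is `approx_lindblad_mOp`.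
Averages commute up to `O(1/N)`, so `𝓛_N[m_α^N]` is, up to `O(1/N)`, the expression `f_α` with the
numbers `m_β` replaced by `m_β^N`. Replacing bounded averages by numbers again costs, in mean
square, a multiple of the variance; for the rates this uses a factorisation `Γ(x) - Γ(y) = g (x -
y)` with bounded `g`. One dissipative term carries a prefactor `N`, but it consists of products with
two commutators, hence of size `O(N⁻²)` before that factor (`small_dissipator_remainder`).

Positivity enters twice. The functional `ω_t` must remain a state, and `m(t)` must remain in the
compact set of one-particle states; the latter gives global existence and uniform constants. Since
`f` is a one-particle Lindblad generator depending on `m` (`meanField_eq`), both follow from the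
invariance theorem `mem_of_subtangent` and one observation, `IsLindblad.exists_isState`: an Euler
step of length `δ` along a Lindblad generator ends within `O(δ²)` of a state. The initial value is
admissible as a limit of averages of one-site states (`mem_stateSet_of_tendsto`). -/

/-! ### States of a `C⋆`-algebra -/

section States

variable {A : Type*} [CStarAlgebra A]

/-- A linear functional that is nonnegative at all `a† a`. -/
def IsPositive (φ : A →ₗ[ℂ] ℂ) : Prop := ∀ a, 0 ≤ φ (star a * a)

/-- A positive normalized linear functional. -/
structure IsState (φ : A →ₗ[ℂ] ℂ) : Prop where
  pos : IsPositive φ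
  map_one : φ 1 = 1

/-- Positive elements are of the form `c† c`. This converts an operator inequality into the only
kind of element that `IsPositive` speaks about. -/
lemma exists_norm_sq_sub_star_mul_self (a : A) :
    ∃ c : A, star c * c = ((‖a‖ ^ 2 : ℝ) : ℂ) • 1 - star a * a := by
  let _ := CStarAlgebra.spectralOrder A
  have := CStarAlgebra.spectralOrderedRing A
  have h : star a * a ≤ algebraMap ℝ A (‖a‖ ^ 2) := CStarAlgebra.star_mul_le_algebraMap_norm_sq
  rw [← sub_nonneg, CStarAlgebra.nonneg_iff_eq_star_mul_self] at h
  obtain ⟨c, hc⟩ := h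
  exact ⟨c, by rw [← hc, Algebra.algebraMap_eq_smul_one, Complex.coe_smul]⟩

namespace IsPositive

variable {φ : A →ₗ[ℂ] ℂ}

/-- Polarisation: reality of `φ` at `(a+1)†(a+1)` compares the imaginary parts, and at `(a+i)†(a+i)`
the real parts. -/
lemma map_star (hφ : IsPositive φ) (a : A) : φ (star a) = conj (φ a) := by
  have h0 := (Complex.nonneg_iff.1 (hφ a)).2
  have h00 := (Complex.nonneg_iff.1 (hφ 1)).2
  have h1 := (Complex.nonneg_iff.1 (hφ (a + 1))).2
  have h2 := (Complex.nonneg_iff.1 (hφ (a + Complex.I • 1))).2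
  simp only [star_add, star_one, add_mul, mul_add, one_mul, mul_one, map_add, Complex.add_im,
    star_smul, smul_mul_assoc, mul_smul_comm, map_smul, smul_eq_mul, Complex.star_def,
    Complex.conj_I, Complex.mul_im, Complex.I_re, Complex.I_im, Complex.neg_im, Complex.neg_re,
    Complex.mul_re] at h0 h00 h1 h2
  apply Complex.ext
  · rw [Complex.conj_re]; linarith
  · rw [Complex.conj_im]; linarith

lemma comp_conj (hφ : IsPositive φ) (a b : A) : 0 ≤ φ (star b * (star a * a) * b) := by
  have := hφ (a * b)
  rwa [star_mul, mul_assoc, ← mul_assoc (star a), ← mul_assoc] at this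

lemma re_nonneg (hφ : IsPositive φ) (a : A) : 0 ≤ (φ (star a * a)).re :=
  (Complex.nonneg_iff.1 (hφ a)).1

lemma im_eq_zero (hφ : IsPositive φ) {a : A} (ha : IsSelfAdjoint a) : (φ a).im = 0 := by
  have := hφ.map_star a
  rw [ha.star_eq] at this
  exact Complex.conj_eq_iff_im.1 this.symm

lemma sq_re_nonneg (hφ : IsPositive φ) {a : A} (ha : IsSelfAdjoint a) : 0 ≤ (φ (a ^ 2)).re := by
  have := hφ.re_nonneg a
  rwa [ha.star_eq, ← sq] at this

/-- With `c† c = ‖b‖² - b† b`, the difference of the two sides is the value at `(c y)†(c y)`. -/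
lemma mul_left_le (hφ : IsPositive φ) (b y : A) :
    (φ (star (b * y) * (b * y))).re ≤ ‖b‖ ^ 2 * (φ (star y * y)).re := by
  obtain ⟨c, hc⟩ := exists_norm_sq_sub_star_mul_self b
  have h := hφ.re_nonneg (c * y)
  have e : star (c * y) * (c * y) =
      ((‖b‖ ^ 2 : ℝ) : ℂ) • (star y * y) - star (b * y) * (b * y) := by
    calc star (c * y) * (c * y) = star y * (star c * c) * y := by
          rw [star_mul]; noncomm_ring
      _ = _ := by
          rw [hc, star_mul, mul_sub, sub_mul, mul_smul_comm, smul_mul_assoc, mul_one]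
          congr 1
          noncomm_ring
  rw [e, map_sub, map_smul, smul_eq_mul, Complex.sub_re, Complex.re_ofReal_mul] at h
  linarith

lemma add_le (hφ : IsPositive φ) (y z : A) :
    (φ (star (y + z) * (y + z))).re ≤
      2 * (φ (star y * y)).re + 2 * (φ (star z * z)).re := by
  have h := hφ.re_nonneg (y - z)
  simp only [star_sub, star_add, sub_mul, mul_sub, add_mul, mul_add, map_sub, map_add,
    Complex.sub_re, Complex.add_re] at h ⊢
  linarith

/-- Positivity at `(y - x)²` and `(y + x)²`. It is later applied to the cross term `YX + XY`. -/
lemma abs_re_anticomm_le (hφ : IsPositive φ) {y x : A} (hy : IsSelfAdjoint y)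
    (hx : IsSelfAdjoint x) :
    |(φ (y * x + x * y)).re| ≤ (φ (star y * y)).re + (φ (x ^ 2)).re := by
  have h := hφ.re_nonneg (y - x)
  have h' := hφ.re_nonneg (y + x)
  simp only [star_sub, star_add, sub_mul, mul_sub, add_mul, mul_add, map_sub, map_add,
    Complex.sub_re, Complex.add_re, hy.star_eq, hx.star_eq, sq] at h h' ⊢
  rw [abs_le]
  constructor <;> linarith

end IsPositive

namespace IsState

variable {φ : A →ₗ[ℂ] ℂ}

/-- Supplies `‖1‖ = 1`, which fails in the zero algebra (the case `d = 0`). -/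
lemma nontrivial (hφ : IsState φ) : Nontrivial A := by
  refine ⟨⟨1, 0, fun h => ?_⟩⟩
  have := hφ.map_one
  rw [h, map_zero] at this
  exact zero_ne_one this

lemma re_star_mul_self_le (hφ : IsState φ) (a : A) : (φ (star a * a)).re ≤ ‖a‖ ^ 2 := by
  have := hφ.pos.mul_left_le a 1
  simpa [hφ.map_one] using this

/-- The variance `φ((a - φ a)†(a - φ a))` is nonnegative. -/
lemma sq_norm_apply_le (hφ : IsState φ) (a : A) : ‖φ a‖ ^ 2 ≤ (φ (star a * a)).re := by
  have h := hφ.pos.re_nonneg (a - φ a • 1)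
  simp only [star_sub, star_smul, star_one, sub_mul, mul_sub, smul_mul_assoc, mul_smul_comm,
    one_mul, mul_one, map_sub, map_smul, smul_eq_mul, hφ.map_one, hφ.pos.map_star,
    Complex.star_def, Complex.sub_re] at h
  have e : (conj (φ a) * φ a).re = ‖φ a‖ ^ 2 := by
    rw [← Complex.normSq_eq_conj_mul_self, Complex.ofReal_re, Complex.normSq_eq_norm_sq]
  have e' : (φ a * conj (φ a)).re = ‖φ a‖ ^ 2 := by rw [mul_comm, e]
  rw [e, e'] at h
  linarith

lemma norm_apply_le (hφ : IsState φ) (a : A) : ‖φ a‖ ≤ ‖a‖ :=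
  (pow_le_pow_iff_left₀ (norm_nonneg _) (norm_nonneg _) two_ne_zero).1
    ((hφ.sq_norm_apply_le a).trans (hφ.re_star_mul_self_le a))

/-- A state as a continuous functional. -/
def toCLM (hφ : IsState φ) : A →L[ℂ] ℂ :=
  φ.mkContinuous 1 fun a => by rw [one_mul]; exact hφ.norm_apply_le a

@[simp] lemma toCLM_apply (hφ : IsState φ) (a : A) : hφ.toCLM a = φ a := rfl

lemma norm_le_one {φ : A →L[ℂ] ℂ} (hφ : IsState (φ : A →ₗ[ℂ] ℂ)) : ‖φ‖ ≤ 1 :=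
  φ.opNorm_le_bound zero_le_one fun a => by rw [one_mul]; exact hφ.norm_apply_le a

end IsState

lemma isClosed_setOf_isState : IsClosed {φ : A →L[ℂ] ℂ | IsState (φ : A →ₗ[ℂ] ℂ)} := by
  have : {φ : A →L[ℂ] ℂ | IsState (φ : A →ₗ[ℂ] ℂ)} =
      (⋂ a : A, {φ | φ (star a * a) ∈ {z : ℂ | 0 ≤ z}}) ∩ {φ | φ 1 = 1} := by
    ext φ
    simp only [mem_ofPred_eq, mem_inter_iff, mem_iInter]
    exact ⟨fun h => ⟨h.pos, h.map_one⟩, fun h => ⟨h.1, h.2⟩⟩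
  rw [this]
  refine (isClosed_iInter fun a => ?_).inter ?_
  · exact isClosed_Ici.preimage (ContinuousLinearMap.apply ℂ ℂ (star a * a)).continuous
  · exact isClosed_eq (ContinuousLinearMap.apply ℂ ℂ (1 : A)).continuous continuous_const

/-- `L` is the sum of `a ↦ K† a + a K` and a completely positive map, and `L 1 = 0`; complete
positivity enters only through the dual action on positive functionals. -/
structure IsLindblad (L : A →L[ℂ] A) (K : A) : Prop where
  map_one : L 1 = 0
  pos : ∀ φ : A →ₗ[ℂ] ℂ, IsPositive φ → ∀ a,
    0 ≤ φ (L (star a * a) - star K * (star a * a) - star a * a * K)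

/-- Adding the second-order term `δ² φ(K† · K)` to the Euler step completes a square: the sum is
`φ((1+δK)† · (1+δK))` plus `δ` times the completely positive part, hence positive. Its value at `1`
is `1 + δ² φ(K†K)`, so normalising changes it only at order `δ²`. -/
lemma IsLindblad.exists_isState {L : A →L[ℂ] A} {K : A} (hL : IsLindblad L K) {φ : A →L[ℂ] ℂ}
    (hφ : IsState (φ : A →ₗ[ℂ] ℂ)) {δ : ℝ} (hδ : 0 < δ) :
    ∃ ψ : A →L[ℂ] ℂ, IsState (ψ : A →ₗ[ℂ] ℂ) ∧
      ‖φ + δ • φ.comp L - ψ‖ ≤ 2 * ‖K‖ ^ 2 * δ ^ 2 := by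
  have := hφ.nontrivial
  set κ : A →L[ℂ] ℂ := φ.comp ((ContinuousLinearMap.mul ℂ A (star K)).comp
    ((ContinuousLinearMap.mul ℂ A).flip K)) with hκ
  have κ_apply : ∀ a, κ a = φ (star K * (a * K)) := fun a => rfl
  set c : ℝ := (φ (star K * K)).re with hc
  have hc0 : 0 ≤ c := hφ.pos.re_nonneg K
  have hcφ : φ (star K * K) = c := by
    apply Complex.ext
    · simp [hc]
    · rw [Complex.ofReal_im]
      exact (Complex.nonneg_iff.1 (hφ.pos K)).2.symm
  have hcK : c ≤ ‖K‖ ^ 2 := hφ.re_star_mul_self_le K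
  have hκK : ‖κ‖ ≤ ‖K‖ ^ 2 := by
    refine κ.opNorm_le_bound (by positivity) fun a => ?_
    rw [κ_apply]
    refine (hφ.norm_apply_le _).trans ((norm_mul_le _ _).trans ?_)
    rw [norm_star]
    calc ‖K‖ * ‖a * K‖ ≤ ‖K‖ * (‖a‖ * ‖K‖) := by gcongr; exact norm_mul_le _ _
      _ = _ := by ring
  have hs : 0 < 1 + δ ^ 2 * c := by positivity
  set χ : A →L[ℂ] ℂ := φ + δ • φ.comp L + (δ ^ 2) • κ with hχ
  have χ_apply : ∀ a, χ a = φ a + δ * φ (L a) + (δ : ℂ) ^ 2 * φ (star K * (a * K)) := by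
    intro a
    simp [hχ, κ_apply]
  set ψ : A →L[ℂ] ℂ := (1 + δ ^ 2 * c)⁻¹ • χ with hψ
  have hψs : IsState (ψ : A →ₗ[ℂ] ℂ) := by
    constructor
    · intro a
      have h1 := hφ.pos.comp_conj a (1 + (δ : ℂ) • K)
      have h2 := hL.pos _ hφ.pos a
      have hδ' : (0 : ℂ) ≤ δ := by exact_mod_cast hδ.le
      have h3 := add_nonneg h1 (mul_nonneg hδ' h2)
      have e : χ (star a * a) = φ (star (1 + (δ : ℂ) • K) * (star a * a) * (1 + (δ : ℂ) • K)) +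
          δ * φ (L (star a * a) - star K * (star a * a) - star a * a * K) := by
        rw [χ_apply]
        simp only [star_add, star_one, star_smul, add_mul, mul_add, one_mul, mul_one, map_add,
          smul_mul_assoc, mul_smul_comm, map_smul, map_sub, smul_eq_mul, Complex.star_def,
          Complex.conj_ofReal, mul_assoc]
        ring
      have hi : (0 : ℂ) ≤ ((1 + δ ^ 2 * c)⁻¹ : ℝ) := by exact_mod_cast (inv_pos.2 hs).le
      have h4 := mul_nonneg hi h3
      simp only [ContinuousLinearMap.coe_coe] at h4
      rw [← e] at h4
      rw [ContinuousLinearMap.coe_coe, hψ, smul_apply, Complex.real_smul]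
      exact h4
    · have h1 : φ 1 = 1 := hφ.map_one
      have h2 : χ 1 = ((1 + δ ^ 2 * c : ℝ) : ℂ) := by
        rw [χ_apply, hL.map_one, map_zero, h1, one_mul, hcφ]
        push_cast
        ring
      rw [ContinuousLinearMap.coe_coe, hψ, smul_apply, h2, Complex.real_smul,
        ← Complex.ofReal_mul, inv_mul_cancel₀ hs.ne', Complex.ofReal_one]
  refine ⟨ψ, hψs, ?_⟩
  have e : φ + δ • φ.comp L - ψ = (δ ^ 2) • (c • ψ - κ) := by
    have h1 : (1 + δ ^ 2 * c) • ψ = χ := by rw [hψ, smul_inv_smul₀ hs.ne']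
    have h2 : φ + δ • φ.comp L = (1 + δ ^ 2 * c) • ψ - (δ ^ 2) • κ := by
      rw [h1, hχ]; abel
    rw [h2]
    ext a
    simp only [sub_apply, smul_apply, Complex.real_smul]
    push_cast
    ring
  rw [e, norm_smul, Real.norm_of_nonneg (by positivity)]
  have : ‖c • ψ - κ‖ ≤ 2 * ‖K‖ ^ 2 := by
    refine (norm_sub_le _ _).trans ?_
    rw [norm_smul, Real.norm_of_nonneg hc0]
    nlinarith [hψs.norm_le_one, norm_nonneg ψ]
  calc δ ^ 2 * ‖c • ψ - κ‖ ≤ δ ^ 2 * (2 * ‖K‖ ^ 2) := by gcongr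
    _ = _ := by ring

end States

/-! ### Invariance of closed sets under differential equations -/

/-- Nagumo's theorem with a quadratic error: a closed set to which a Lipschitz vector field is
subtangent is invariant under the flow. -/
theorem mem_of_subtangent {E : Type*} [NormedAddCommGroup E] [NormedSpace ℝ E] {F : E → E}
    {K : ℝ≥0} (hF : LipschitzWith K F) {S : Set E} (hS : IsClosed S) {C : ℝ}
    (hC : ∀ s ∈ S, ∀ δ : ℝ, 0 < δ → ∃ s' ∈ S, ‖s + δ • F s - s'‖ ≤ C * δ ^ 2)
    {x : ℝ → E} {T : ℝ} (hx : ContinuousOn x (Icc 0 T))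
    (hx' : ∀ t ∈ Ico 0 T, HasDerivWithinAt x (F (x t)) (Ici t) t) (h0 : x 0 ∈ S) :
    ∀ t ∈ Icc 0 T, x t ∈ S := by
  have hne : S.Nonempty := ⟨_, h0⟩
  have hC' : ∀ (y : E) (δ : ℝ), 0 < δ → Metric.infDist (y + δ • F y) S ≤
      (1 + δ * K) * (Metric.infDist y S + δ ^ 2) + C * δ ^ 2 := by
    intro y δ hδ
    -- The distance to `S` need not be attained; a slack of `δ²` is harmless because the error is
    -- quadratic anyway.
    obtain ⟨s, hs, hys⟩ := (Metric.infDist_lt_iff hne).1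
      (lt_add_of_pos_right (Metric.infDist y S) (by positivity : 0 < δ ^ 2))
    obtain ⟨s', hs', hss'⟩ := hC s hs δ hδ
    refine (Metric.infDist_le_dist_of_mem hs').trans ?_
    have h1 : dist (y + δ • F y) (s + δ • F s) ≤ (1 + δ * K) * dist y s := by
      calc dist (y + δ • F y) (s + δ • F s) ≤ dist y s + dist (δ • F y) (δ • F s) :=
            dist_add_add_le _ _ _ _
        _ = dist y s + δ * dist (F y) (F s) := by
            rw [dist_smul₀, Real.norm_of_nonneg hδ.le]
        _ ≤ dist y s + δ * (K * dist y s) := by gcongr; exact hF.dist_le_mul _ _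
        _ = _ := by ring
    have h2 : (1 + δ * K) * dist y s ≤ (1 + δ * K) * (Metric.infDist y S + δ ^ 2) := by
      gcongr
    rw [← dist_eq_norm] at hss'
    linarith [dist_triangle (y + δ • F y) (s + δ • F s) s']
  -- Grönwall for the distance to `S`: its upper right derivative is at most `K` times itself, and
  -- it starts at zero.
  have key := le_gronwallBound_of_liminf_deriv_right_le (f := fun t => Metric.infDist (x t) S)
    (f' := fun t => K * Metric.infDist (x t) S) (δ := 0) (K := K) (ε := 0) (a := 0) (b := T)
    ((Metric.continuous_infDist_pt S).comp_continuousOn hx) ?_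
    (by rw [Metric.infDist_zero_of_mem h0]) (fun t _ => by simp)
  · intro t ht
    have h1 := key t ht
    rw [gronwallBound_ε0_δ0] at h1
    exact (hS.mem_iff_infDist_zero hne).2 (le_antisymm h1 Metric.infDist_nonneg)
  · intro t ht r hr
    apply Eventually.frequently
    set ρ := Metric.infDist (x t) S with hρ
    have hρ0 : 0 ≤ ρ := Metric.infDist_nonneg
    -- Half of the available gap pays for the remainder of the derivative, the other half for the
    -- quadratic error.
    set η := (r - K * ρ) / 2 with hη
    have hη0 : 0 < η := by rw [hη]; linarith
    have hd := (hasDerivWithinAt_iff_isLittleO.1 (hx' t ht)).def hη0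
    have hd' : ∀ᶠ z in 𝓝[>] t, ‖x z - x t - (z - t) • F (x t)‖ ≤ η * ‖z - t‖ :=
      hd.filter_mono (nhdsWithin_mono t Ioi_subset_Ici_self)
    have hlim : Tendsto (fun z : ℝ => (1 + (z - t) * K + C) * (z - t)) (𝓝[>] t) (𝓝 0) := by
      have : Tendsto (fun z : ℝ => (1 + (z - t) * K + C) * (z - t)) (𝓝 t)
          (𝓝 ((1 + (t - t) * K + C) * (t - t))) := by
        apply Continuous.tendsto
        fun_prop
      rw [sub_self, mul_zero] at this
      exact this.mono_left nhdsWithin_le_nhds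
    filter_upwards [hd', hlim.eventually (gt_mem_nhds hη0), self_mem_nhdsWithin] with z h1 h2 h3
    have hz : 0 < z - t := sub_pos.2 h3
    rw [Real.norm_of_nonneg hz.le] at h1
    have h4 := hC' (x t) (z - t) hz
    have h5 : Metric.infDist (x z) S ≤ Metric.infDist (x t + (z - t) • F (x t)) S +
        η * (z - t) := by
      refine (Metric.infDist_le_infDist_add_dist (y := x t + (z - t) • F (x t))).trans ?_
      gcongr
      rw [dist_eq_norm, ← sub_sub]
      exact h1
    rw [inv_mul_lt_iff₀ hz]
    have h6 : Metric.infDist (x z) S - ρ ≤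
        (z - t) * (K * ρ + η + (1 + (z - t) * K + C) * (z - t)) := by
      nlinarith [h4, h5]
    refine h6.trans_lt ((mul_lt_mul_iff_right₀ hz).2 ?_)
    rw [hη] at h2 ⊢
    linarith

/-! ### Preservation of states by Lindblad semigroups -/

section Semigroup

variable {A : Type*} [CStarAlgebra A]

lemma hasDerivAt_exp_real_smul (L : A →L[ℂ] A) (t : ℝ) :
    HasDerivAt (fun s : ℝ => NormedSpace.exp ((s : ℂ) • L))
      (NormedSpace.exp ((t : ℂ) • L) * L) t := by
  have h (s : ℝ) : (s : ℂ) • L = s • L := rfl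
  simp only [h]
  exact hasDerivAt_exp_smul_const (𝕂 := ℝ) L t

/-- The dual of a semigroup with a Lindblad generator preserves states. -/
theorem IsLindblad.isState_exp {L : A →L[ℂ] A} {K : A} (hL : IsLindblad L K) {φ : A →L[ℂ] ℂ}
    (hφ : IsState (φ : A →ₗ[ℂ] ℂ)) {t : ℝ} (ht : 0 ≤ t) :
    IsState (φ.comp (NormedSpace.exp ((t : ℂ) • L)) : A →ₗ[ℂ] ℂ) := by
  -- `R ψ = ψ ∘ L` is the dual generator, so `s ↦ φ ∘ e^{sL}` solves the linear equation `ψ' = R ψ`.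
  let R : (A →L[ℂ] ℂ) →L[ℂ] (A →L[ℂ] ℂ) := (ContinuousLinearMap.compL ℂ A A ℂ).flip L
  let R' : (A →L[ℂ] A) →L[ℂ] (A →L[ℂ] ℂ) := ContinuousLinearMap.compL ℂ A A ℂ φ
  have hd : ∀ s : ℝ, HasDerivAt (fun s : ℝ => φ.comp (NormedSpace.exp ((s : ℂ) • L)))
      (R (φ.comp (NormedSpace.exp ((s : ℂ) • L)))) s := fun s =>
    ((R'.restrictScalars ℝ).hasFDerivAt.comp_hasDerivAt s (hasDerivAt_exp_real_smul L s))
  refine mem_of_subtangent (F := R) (K := ‖R‖₊) R.lipschitz isClosed_setOf_isState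
    (C := 2 * ‖K‖ ^ 2) (fun ψ hψ δ hδ => hL.exists_isState hψ hδ)
    (x := fun s : ℝ => φ.comp (NormedSpace.exp ((s : ℂ) • L))) (T := t)
    (fun s _ => (hd s).continuousAt.continuousWithinAt) (fun s _ => (hd s).hasDerivWithinAt)
    ?_ t ⟨ht, le_rfl⟩
  rw [show φ.comp (NormedSpace.exp (((0 : ℝ) : ℂ) • L)) = φ by
    rw [show ((0 : ℝ) : ℂ) • L = 0 by ext; simp, NormedSpace.exp_zero]; rfl]
  exact hφ

end Semigroup

/-! ### Power series in a Banach algebra -/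

section PowerSeries

/-- `∑ cₙ xⁿ` in a Banach algebra. -/
def powSeries {A : Type*} [NormedRing A] [NormedAlgebra ℂ A] (c : ℕ → ℝ) (x : A) : A :=
  ∑' n, (c n : ℂ) • x ^ n

/-- The value at `4 * R` of the series of absolute values. -/
def majorant (c : ℕ → ℝ) (R : ℝ) : ℝ := ∑' n, |c n| * (4 * R) ^ n

lemma mul_lie_eq {A : Type*} [Ring A] (x y b : A) : ⁅x * y, b⁆ = x * ⁅y, b⁆ + ⁅x, b⁆ * y := by
  simp only [Ring.lie_def]; noncomm_ring

lemma add_lie_eq {A : Type*} [Ring A] (x y b : A) : ⁅x + y, b⁆ = ⁅x, b⁆ + ⁅y, b⁆ := by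
  simp only [Ring.lie_def]; noncomm_ring

/-! ### Single and double commutators of powers -/

section Powers

variable {A : Type*} [NormedRing A] [NormOneClass A] {x : A} {R : ℝ}

lemma norm_pow_le_of_le (hx : ‖x‖ ≤ R) (n : ℕ) : ‖x ^ n‖ ≤ R ^ n :=
  (norm_pow_le x n).trans (by gcongr)

/-- Leibniz: one term for each of the `n` factors. Taking `R ≥ 1` permits `R ^ n` in place of `R ^
(n - 1)`. -/
lemma norm_pow_lie_le (hR : 1 ≤ R) (hx : ‖x‖ ≤ R) (b : A) (n : ℕ) :
    ‖⁅x ^ n, b⁆‖ ≤ n * R ^ n * ‖⁅x, b⁆‖ := by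
  induction n with
  | zero => simp [Ring.lie_def]
  | succ n ih =>
    rw [pow_succ, mul_lie_eq]
    have hp : R ^ n ≤ R ^ (n + 1) := pow_le_pow_right₀ hR n.le_succ
    calc ‖x ^ n * ⁅x, b⁆ + ⁅x ^ n, b⁆ * x‖
        ≤ ‖x ^ n‖ * ‖⁅x, b⁆‖ + ‖⁅x ^ n, b⁆‖ * ‖x‖ :=
          (norm_add_le _ _).trans (add_le_add (norm_mul_le _ _) (norm_mul_le _ _))
      _ ≤ R ^ (n + 1) * ‖⁅x, b⁆‖ + (n * R ^ n * ‖⁅x, b⁆‖) * R := by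
          gcongr
          exact (norm_pow_le_of_le hx n).trans hp
      _ = _ := by push_cast; ring

/-- Leibniz twice: `n` terms with both commutators on one factor and `n(n-1)` terms with them on two
different factors. -/
lemma norm_pow_lie_lie_le (hR : 1 ≤ R) (hx : ‖x‖ ≤ R) (a b : A) (n : ℕ) :
    ‖⁅⁅x ^ n, a⁆, b⁆‖ ≤
      (n : ℝ) ^ 2 * R ^ n * (‖⁅⁅x, a⁆, b⁆‖ + ‖⁅x, a⁆‖ * ‖⁅x, b⁆‖) := by
  induction n with
  | zero => simp [Ring.lie_def]
  | succ n ih =>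
    have e : ⁅⁅x ^ (n + 1), a⁆, b⁆ = x ^ n * ⁅⁅x, a⁆, b⁆ + ⁅x ^ n, b⁆ * ⁅x, a⁆ +
        (⁅x ^ n, a⁆ * ⁅x, b⁆ + ⁅⁅x ^ n, a⁆, b⁆ * x) := by
      rw [pow_succ, mul_lie_eq, add_lie_eq, mul_lie_eq, mul_lie_eq]
    have hp : R ^ n ≤ R ^ (n + 1) := pow_le_pow_right₀ hR n.le_succ
    have h1 : ‖x ^ n * ⁅⁅x, a⁆, b⁆‖ ≤ R ^ (n + 1) * ‖⁅⁅x, a⁆, b⁆‖ :=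
      (norm_mul_le _ _).trans (by gcongr; exact (norm_pow_le_of_le hx n).trans hp)
    have h2 : ‖⁅x ^ n, b⁆ * ⁅x, a⁆‖ ≤ n * R ^ (n + 1) * ‖⁅x, b⁆‖ * ‖⁅x, a⁆‖ :=
      (norm_mul_le _ _).trans (by
        gcongr
        refine (norm_pow_lie_le hR hx b n).trans ?_
        gcongr)
    have h3 : ‖⁅x ^ n, a⁆ * ⁅x, b⁆‖ ≤ n * R ^ (n + 1) * ‖⁅x, a⁆‖ * ‖⁅x, b⁆‖ :=
      (norm_mul_le _ _).trans (by
        gcongr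
        refine (norm_pow_lie_le hR hx a n).trans ?_
        gcongr)
    have h4 : ‖⁅⁅x ^ n, a⁆, b⁆ * x‖ ≤
        (n : ℝ) ^ 2 * R ^ n * (‖⁅⁅x, a⁆, b⁆‖ + ‖⁅x, a⁆‖ * ‖⁅x, b⁆‖) * R :=
      (norm_mul_le _ _).trans (by gcongr)
    rw [e]
    refine (norm_add_le_of_le (norm_add_le_of_le h1 h2) (norm_add_le_of_le h3 h4)).trans ?_
    have h5 : 0 ≤ R ^ (n + 1) * ‖⁅⁅x, a⁆, b⁆‖ := by positivity
    have h6 : 0 ≤ R ^ (n + 1) * (‖⁅x, a⁆‖ * ‖⁅x, b⁆‖) := by positivity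
    have hn : (0 : ℝ) ≤ n := n.cast_nonneg
    -- The target minus the bounds just collected, written as an explicitly nonnegative remainder;
    -- `(n+1)² - n² = 2n + 1`.
    have h7 : ((n + 1 : ℕ) : ℝ) ^ 2 * R ^ (n + 1) *
        (‖⁅⁅x, a⁆, b⁆‖ + ‖⁅x, a⁆‖ * ‖⁅x, b⁆‖) =
        R ^ (n + 1) * ‖⁅⁅x, a⁆, b⁆‖ + n * R ^ (n + 1) * ‖⁅x, b⁆‖ * ‖⁅x, a⁆‖ +
          (n * R ^ (n + 1) * ‖⁅x, a⁆‖ * ‖⁅x, b⁆‖ +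
            (n : ℝ) ^ 2 * R ^ n * (‖⁅⁅x, a⁆, b⁆‖ + ‖⁅x, a⁆‖ * ‖⁅x, b⁆‖) * R) +
        (2 * (n * (R ^ (n + 1) * ‖⁅⁅x, a⁆, b⁆‖)) +
          R ^ (n + 1) * (‖⁅x, a⁆‖ * ‖⁅x, b⁆‖)) := by
      push_cast
      ring
    rw [h7]
    exact le_add_of_nonneg_right (by positivity)

lemma norm_pow_le_four_pow (hR : 1 ≤ R) (hx : ‖x‖ ≤ R) (n : ℕ) :
    ‖x ^ n‖ ≤ 4 ^ n * R ^ n * 1 := by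
  rw [mul_one]
  exact (norm_pow_le_of_le hx n).trans
    (le_mul_of_one_le_left (by positivity) (one_le_pow₀ (by norm_num)))

end Powers

variable {A : Type*} [NormedRing A] [NormedAlgebra ℂ A] {x : A} {R : ℝ} {c : ℕ → ℝ}

/-- The reason for the `4` in `majorant`: it absorbs the polynomial factors produced by commutators,
so that no derivative of the series has to be introduced. -/
lemma natCast_sq_le_four_pow (n : ℕ) : (n : ℝ) ^ 2 ≤ 4 ^ n := by
  have : (n : ℝ) ≤ 2 ^ n := by exact_mod_cast n.lt_two_pow_self.le
  calc (n : ℝ) ^ 2 ≤ (2 ^ n) ^ 2 := by gcongr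
    _ = 4 ^ n := by rw [← pow_mul, mul_comm, pow_mul]; norm_num

lemma natCast_le_four_pow (n : ℕ) : (n : ℝ) ≤ 4 ^ n := by
  have h : n ≤ 4 ^ n := (Nat.lt_pow_self (by norm_num)).le
  exact_mod_cast h

lemma hasSum_majorant (hc : ∀ z : ℝ, Summable fun n => |c n| * |z| ^ n) (hR : 1 ≤ R) :
    HasSum (fun n => |c n| * (4 * R) ^ n) (majorant c R) := by
  have := hc (4 * R)
  rw [abs_of_nonneg (by linarith)] at this
  exact this.hasSum

lemma abs_mul_le_majorant_term (n : ℕ) {w v : ℝ}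
    (hw : w ≤ 4 ^ n * R ^ n * v) : |c n| * w ≤ |c n| * (4 * R) ^ n * v := by
  rw [mul_pow, mul_assoc]
  gcongr

lemma norm_tsum_smul_le (hc : ∀ z : ℝ, Summable fun n => |c n| * |z| ^ n) (hR : 1 ≤ R)
    {f : ℕ → A} {v : ℝ} (hf : ∀ n, ‖f n‖ ≤ 4 ^ n * R ^ n * v) :
    ‖∑' n, (c n : ℂ) • f n‖ ≤ majorant c R * v := by
  refine tsum_of_norm_bounded ((hasSum_majorant hc hR).mul_right v) fun n => ?_
  rw [norm_smul, Complex.norm_real, Real.norm_eq_abs]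
  exact abs_mul_le_majorant_term n (hf n)

lemma summable_smul_of_le [CompleteSpace A]
    (hc : ∀ z : ℝ, Summable fun n => |c n| * |z| ^ n) (hR : 1 ≤ R)
    {f : ℕ → A} {v : ℝ} (hf : ∀ n, ‖f n‖ ≤ 4 ^ n * R ^ n * v) :
    Summable fun n => (c n : ℂ) • f n := by
  refine Summable.of_norm_bounded ((hasSum_majorant hc hR).mul_right v).summable fun n => ?_
  rw [norm_smul, Complex.norm_real, Real.norm_eq_abs]
  exact abs_mul_le_majorant_term n (hf n)

variable [NormOneClass A]

/-- The telescoping factorisation, valid since the scalar `y` commutes with `x`. The difference is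
kept on the right because `IsPositive.mul_left_le` admits bounded factors on the left. -/
lemma exists_pow_sub_pow_factor (hR : 1 ≤ R) (hx : ‖x‖ ≤ R) {y : ℝ} (hy : |y| ≤ R) (n : ℕ) :
    ∃ g : A, x ^ n - ((y ^ n : ℝ) : ℂ) • (1 : A) = g * (x - (y : ℂ) • 1) ∧ ‖g‖ ≤ n * R ^ n := by
  induction n with
  | zero => exact ⟨0, by simp⟩
  | succ n ih =>
    obtain ⟨g, hg, hgn⟩ := ih
    -- From `x^(n+1) - y^(n+1) = x^n (x - y) + y (x^n - y^n)`.
    refine ⟨x ^ n + (y : ℂ) • g, ?_, ?_⟩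
    · rw [add_mul, smul_mul_assoc, ← hg, pow_succ x n, mul_sub, smul_sub, smul_smul,
        mul_smul_comm, mul_one, pow_succ']
      push_cast
      abel
    · have hp : R ^ n ≤ R ^ (n + 1) := pow_le_pow_right₀ hR n.le_succ
      calc ‖x ^ n + (y : ℂ) • g‖ ≤ ‖x ^ n‖ + |y| * ‖g‖ := by
            refine (norm_add_le _ _).trans ?_
            rw [norm_smul, Complex.norm_real, Real.norm_eq_abs]
        _ ≤ R ^ (n + 1) + R * (n * R ^ n) := by
            gcongr
            exact (norm_pow_le_of_le hx n).trans hp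
        _ = _ := by push_cast; ring

lemma norm_powSeries_le (hc : ∀ z : ℝ, Summable fun n => |c n| * |z| ^ n) (hR : 1 ≤ R)
    (hx : ‖x‖ ≤ R) : ‖powSeries c x‖ ≤ majorant c R := by
  rw [← mul_one (majorant c R)]
  exact norm_tsum_smul_le hc hR (norm_pow_le_four_pow hR hx)

variable [CompleteSpace A]

/-- The commutator `x ↦ ⁅x, b⁆` as a bounded operator. -/
def commWith {A : Type*} [NormedRing A] [NormedAlgebra ℂ A] (b : A) : A →L[ℂ] A :=
  (ContinuousLinearMap.mul ℂ A).flip b - ContinuousLinearMap.mul ℂ A b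

lemma commWith_apply {A : Type*} [NormedRing A] [NormedAlgebra ℂ A] (b x : A) :
    commWith b x = ⁅x, b⁆ := by
  simp [commWith, Ring.lie_def]

lemma powSeries_lie (hc : ∀ z : ℝ, Summable fun n => |c n| * |z| ^ n) (hR : 1 ≤ R)
    (hx : ‖x‖ ≤ R) (b : A) : ⁅powSeries c x, b⁆ = ∑' n, (c n : ℂ) • ⁅x ^ n, b⁆ := by
  rw [← commWith_apply, powSeries,
    (commWith b).map_tsum (summable_smul_of_le hc hR (norm_pow_le_four_pow hR hx))]
  simp only [map_smul, commWith_apply]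

/-- Commutators of order `1/N` with `x` remain of order `1/N` with the series in `x`. -/
lemma norm_powSeries_lie_le (hc : ∀ z : ℝ, Summable fun n => |c n| * |z| ^ n) (hR : 1 ≤ R)
    (hx : ‖x‖ ≤ R) (b : A) : ‖⁅powSeries c x, b⁆‖ ≤ majorant c R * ‖⁅x, b⁆‖ := by
  rw [powSeries_lie hc hR hx]
  refine norm_tsum_smul_le hc hR fun n => (norm_pow_lie_le hR hx b n).trans ?_
  gcongr
  exact natCast_le_four_pow n

/-- The same for double commutators, where both contributions on the right will be of order `N⁻²`.
-/
lemma norm_powSeries_lie_lie_le (hc : ∀ z : ℝ, Summable fun n => |c n| * |z| ^ n) (hR : 1 ≤ R)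
    (hx : ‖x‖ ≤ R) (a b : A) : ‖⁅⁅powSeries c x, a⁆, b⁆‖ ≤
      majorant c R * (‖⁅⁅x, a⁆, b⁆‖ + ‖⁅x, a⁆‖ * ‖⁅x, b⁆‖) := by
  rw [powSeries_lie hc hR hx, ← commWith_apply, (commWith b).map_tsum]
  · simp only [map_smul, commWith_apply]
    refine norm_tsum_smul_le hc hR fun n =>
      (norm_pow_lie_lie_le hR hx a b n).trans ?_
    gcongr
    exact natCast_sq_le_four_pow n
  · refine summable_smul_of_le hc hR (v := ‖⁅x, a⁆‖) fun n =>
      (norm_pow_lie_le hR hx a n).trans ?_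
    gcongr
    exact natCast_le_four_pow n

/-- The factors of the monomials are summed; a norm bound on `g` uniform in `x` and `y` is what
transfers mean-square closeness from `Δ` to `Γ(Δ)`. -/
lemma exists_powSeries_sub_factor (hc : ∀ z : ℝ, Summable fun n => |c n| * |z| ^ n) (hR : 1 ≤ R)
    (hx : ‖x‖ ≤ R) {y : ℝ} (hy : |y| ≤ R) :
    ∃ g : A, powSeries c x - ((∑' n, c n * y ^ n : ℝ) : ℂ) • (1 : A) = g * (x - (y : ℂ) • 1) ∧
      ‖g‖ ≤ majorant c R := by
  choose g hg hgn using exists_pow_sub_pow_factor hR hx hy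
  have hb : ∀ n, ‖g n‖ ≤ 4 ^ n * R ^ n * 1 := fun n => (hgn n).trans (by
    rw [mul_one]; gcongr; exact natCast_le_four_pow n)
  have hs := summable_smul_of_le hc hR hb
  have hy' : Summable fun n => c n * y ^ n := by
    refine Summable.of_norm ?_
    simpa [abs_mul, abs_pow] using hc y
  have hy1 : Summable fun n => (c n : ℂ) • ((y ^ n : ℝ) : ℂ) • (1 : A) := by
    refine summable_smul_of_le hc hR (v := 1) fun n => ?_
    rw [norm_smul, norm_one, Complex.norm_real, norm_pow, Real.norm_eq_abs, mul_one, mul_one]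
    calc |y| ^ n ≤ R ^ n := by gcongr
      _ ≤ 4 ^ n * R ^ n := le_mul_of_one_le_left (by positivity) (one_le_pow₀ (by norm_num))
  have h1 : ((∑' n, c n * y ^ n : ℝ) : ℂ) • (1 : A) =
      ∑' n, (c n : ℂ) • ((y ^ n : ℝ) : ℂ) • (1 : A) := by
    have := ((hy'.hasSum.mapL Complex.ofRealCLM).smul_const (1 : A)).tsum_eq
    rw [Complex.ofRealCLM_apply] at this
    rw [← this]
    simp only [smul_smul, Complex.ofRealCLM_apply, Complex.ofReal_mul]
  refine ⟨∑' n, (c n : ℂ) • g n, ?_, ?_⟩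
  · have h2 := (summable_smul_of_le hc hR (norm_pow_le_four_pow hR hx)).tsum_sub hy1
    have h3 : ∀ n, (c n : ℂ) • x ^ n - (c n : ℂ) • ((y ^ n : ℝ) : ℂ) • (1 : A) =
        (c n : ℂ) • g n * (x - (y : ℂ) • 1) := fun n => by
      rw [← smul_sub, hg, smul_mul_assoc]
    rw [tsum_congr h3, hs.tsum_mul_right (x - (y : ℂ) • 1)] at h2
    rw [h1, h2]
    rfl
  · have := norm_tsum_smul_le hc hR hb
    rwa [mul_one] at this

lemma isSelfAdjoint_powSeries {A : Type*} [CStarAlgebra A] (c : ℕ → ℝ) {x : A}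
    (hx : IsSelfAdjoint x) : IsSelfAdjoint (powSeries c x) := by
  rw [IsSelfAdjoint, powSeries, tsum_star]
  simp [hx.star_eq]

lemma contDiff_tsum_mul_pow (hc : ∀ z : ℝ, Summable fun n => |c n| * |z| ^ n) :
    ContDiff ℝ 1 fun y : ℝ => ∑' n, c n * y ^ n := by
  have hr : (FormalMultilinearSeries.ofScalars ℝ c).radius = ⊤ := by
    apply FormalMultilinearSeries.radius_eq_top_of_summable_norm
    intro r
    refine (hc r).congr fun n => ?_
    simp
  have h := (FormalMultilinearSeries.ofScalars ℝ c).hasFPowerSeriesOnBall (by simp [hr])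
  have h2 : AnalyticOnNhd ℝ (FormalMultilinearSeries.ofScalars ℝ c).sum univ := by
    have := h.analyticOnNhd
    rwa [hr, Metric.eball_top] at this
  have e : (FormalMultilinearSeries.ofScalars ℝ c).sum = fun y : ℝ => ∑' n, c n * y ^ n := by
    funext y
    simp [FormalMultilinearSeries.sum, mul_comm]
  rw [e] at h2
  exact h2.contDiff

end PowerSeries

/-! ### Global solutions of autonomous differential equations -/

section ODE

variable {E : Type*} [NormedAddCommGroup E] [NormedSpace ℝ E]

lemma eqOn_of_hasDerivWithinAt_Icc {F : E → E} {K : ℝ≥0} {S : Set E} (hF : LipschitzOnWith K F S)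
    {T : ℝ} {x y : ℝ → E} (hx : ∀ t ∈ Icc 0 T, HasDerivWithinAt x (F (x t)) (Icc 0 T) t)
    (hy : ∀ t ∈ Icc 0 T, HasDerivWithinAt y (F (y t)) (Icc 0 T) t)
    (hxS : ∀ t ∈ Icc 0 T, x t ∈ S) (hyS : ∀ t ∈ Icc 0 T, y t ∈ S) (h0 : x 0 = y 0) :
    EqOn x y (Icc 0 T) := by
  have h : ∀ z : ℝ → E, (∀ t ∈ Icc 0 T, HasDerivWithinAt z (F (z t)) (Icc 0 T) t) →
      ∀ t ∈ Ico 0 T, HasDerivWithinAt z (F (z t)) (Ici t) t := fun z hz t ht =>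
    (hz t (Ico_subset_Icc_self ht)).mono_of_mem_nhdsWithin
      (mem_of_superset (Icc_mem_nhdsGE ht.2) (Icc_subset_Icc_left ht.1))
  exact ODE_solution_unique_of_mem_Icc_right (v := fun _ => F) (s := fun _ => S)
    (fun _ _ => hF) (fun t ht => (hx t ht).continuousWithinAt) (h x hx)
    (fun t ht => hxS t (Ico_subset_Icc_self ht)) (fun t ht => (hy t ht).continuousWithinAt)
    (h y hy) (fun t ht => hyS t (Ico_subset_Icc_self ht)) h0

/-- A bounded Lipschitz vector field has global forward solutions. -/
theorem exists_forall_hasDerivWithinAt_Ici [CompleteSpace E] {F : E → E} {K : ℝ≥0}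
    (hF : LipschitzWith K F) {B : ℝ≥0} (hB : ∀ y, ‖F y‖ ≤ B) (x₀ : E) :
    ∃ x : ℝ → E, x 0 = x₀ ∧ ∀ t, 0 ≤ t → HasDerivWithinAt x (F (x t)) (Ici 0) t := by
  have hloc : ∀ n : ℕ, ∃ x : ℝ → E, x 0 = x₀ ∧
      ∀ t ∈ Icc (0 : ℝ) n, HasDerivWithinAt x (F (x t)) (Icc (0 : ℝ) n) t := fun n => by
    -- A solution with speed at most `B` moves by at most `B * n` up to time `n`, so a ball of that
    -- radius makes Picard–Lindelöf work on the whole interval.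
    have hp : IsPicardLindelof (fun _ => F) (⟨0, le_rfl, n.cast_nonneg⟩ : Icc (0 : ℝ) n) x₀
        (B * n) 0 B K :=
      { lipschitzOnWith := fun _ _ => hF.lipschitzOnWith
        continuousOn := fun _ _ => continuousOn_const
        norm_le := fun _ _ y _ => hB y
        mul_max_le := by simp }
    exact hp.exists_eq_forall_mem_Icc_hasDerivWithinAt₀
  choose y hy0 hy using hloc
  have huniq : ∀ (m n : ℕ) (s : ℝ), 0 ≤ s → s ≤ m → s ≤ n → y m s = y n s :=
    fun m n s hs hm hn =>
      eqOn_of_hasDerivWithinAt_Icc (S := univ) hF.lipschitzOnWith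
        (fun t ht => (hy m t ⟨ht.1, ht.2.trans hm⟩).mono (Icc_subset_Icc_right hm))
        (fun t ht => (hy n t ⟨ht.1, ht.2.trans hn⟩).mono (Icc_subset_Icc_right hn))
        (fun _ _ => trivial) (fun _ _ => trivial) ((hy0 m).trans (hy0 n).symm) ⟨hs, le_rfl⟩
  have hceil : ∀ s : ℝ, s ≤ ((⌈s⌉₊ + 1 : ℕ) : ℝ) := fun s => by
    push_cast
    exact (Nat.le_ceil s).trans (by linarith)
  -- Gluing of the solutions on `[0, n]`. The `+ 1` keeps `t` strictly below the right end, so that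
  -- the derivative within the interval is the one within `[0, ∞)`.
  refine ⟨fun s => y (⌈s⌉₊ + 1) s, hy0 _, fun t ht => ?_⟩
  set N := ⌈t⌉₊ + 1 with hN
  have htN : t < (N : ℝ) := by
    rw [hN]; push_cast
    exact (Nat.le_ceil t).trans_lt (by linarith)
  have h1 : HasDerivWithinAt (y N) (F (y N t)) (Ici 0) t :=
    (hy N t ⟨ht, htN.le⟩).mono_of_mem_nhdsWithin (by
      rw [← Ici_inter_Iic]
      exact inter_mem_nhdsWithin _ (Iic_mem_nhds htN))
  refine h1.congr_of_eventuallyEq ?_ rfl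
  filter_upwards [self_mem_nhdsWithin, mem_nhdsWithin_of_mem_nhds (Iic_mem_nhds htN)]
    with s hs hsN
  exact huniq _ _ s hs (hceil s) hsN

/-- A `C¹` vector field on a finite-dimensional space that is subtangent to a compact set has
global forward solutions in this set. -/
theorem exists_forall_mem_hasDerivWithinAt_Ici {ι : Type*} [Fintype ι] {F : (ι → ℝ) → ι → ℝ}
    (hF : ContDiff ℝ 1 F) {S : Set (ι → ℝ)} (hS : IsClosed S) {R : ℝ} (hR : ∀ s ∈ S, ‖s‖ ≤ R)
    {C : ℝ} (hC : ∀ s ∈ S, ∀ δ : ℝ, 0 < δ → ∃ s' ∈ S, ‖s + δ • F s - s'‖ ≤ C * δ ^ 2)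
    {x₀ : ι → ℝ} (hx₀ : x₀ ∈ S) :
    ∃ x : ℝ → ι → ℝ, x 0 = x₀ ∧ ∀ t, 0 ≤ t →
      x t ∈ S ∧ HasDerivWithinAt x (F (x t)) (Ici 0) t := by
  have hR0 : 0 ≤ R := (norm_nonneg _).trans (hR x₀ hx₀)
  have hRR : -R ≤ R := by linarith
  -- Truncating the coordinates at `±R` makes the field globally bounded and Lipschitz without
  -- changing it on `S`; invariance of `S` removes the truncation afterwards.
  let clip : (ι → ℝ) → ι → ℝ := fun y i => projIcc (-R) R hRR (y i)
  have hclip : LipschitzWith 1 clip := by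
    refine LipschitzWith.of_dist_le_mul fun y z => ?_
    rw [NNReal.coe_one, one_mul, dist_pi_le_iff dist_nonneg]
    intro i
    calc dist (clip y i) (clip z i) ≤ 1 * dist (y i) (z i) :=
          (LipschitzWith.projIcc hRR).dist_le_mul _ _
      _ ≤ dist y z := by rw [one_mul]; exact dist_le_pi_dist y z i
  have hclip_mem : ∀ y, clip y ∈ Metric.closedBall (0 : ι → ℝ) R := fun y => by
    rw [mem_closedBall_zero_iff, pi_norm_le_iff_of_nonneg hR0]
    intro i
    rw [Real.norm_eq_abs, abs_le]
    exact (projIcc (-R) R hRR (y i)).2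
  have hclip_id : ∀ s ∈ S, clip s = s := fun s hs => by
    funext i
    have : |s i| ≤ R := (norm_le_pi_norm s i).trans (hR s hs)
    exact congrArg Subtype.val (projIcc_of_mem hRR (abs_le.1 this))
  obtain ⟨K, hK⟩ := (hF.contDiffOn (s := Metric.closedBall (0 : ι → ℝ) R)).exists_lipschitzOnWith
    one_ne_zero (convex_closedBall 0 R) (isCompact_closedBall 0 R)
  have hG : LipschitzWith (K * 1) (F ∘ clip) := by
    rw [← lipschitzOnWith_univ] at hclip ⊢
    exact hK.comp hclip fun y _ => hclip_mem y
  obtain ⟨B, hB⟩ := (isCompact_closedBall (0 : ι → ℝ) R).exists_bound_of_continuousOn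
    hF.continuous.continuousOn
  obtain ⟨x, hx0, hx⟩ := exists_forall_hasDerivWithinAt_Ici hG (B := B.toNNReal)
    (fun y => (hB _ (hclip_mem y)).trans (Real.le_coe_toNNReal B)) x₀
  have hmem : ∀ t, 0 ≤ t → x t ∈ S := fun t ht =>
    mem_of_subtangent hG hS (C := C)
      (fun s hs δ hδ => by
        simpa only [Function.comp_apply, hclip_id s hs] using hC s hs δ hδ)
      (fun s hs => (hx s hs.1).continuousWithinAt.mono Icc_subset_Ici_self)
      (fun s hs => (hx s hs.1).mono (Ici_subset_Ici.2 hs.1)) (hx0.symm ▸ hx₀) t ⟨ht, le_rfl⟩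
  refine ⟨x, hx0, fun t ht => ⟨hmem t ht, ?_⟩⟩
  have := hx t ht
  rwa [Function.comp_apply, hclip_id _ (hmem t ht)] at this

/-- Uniqueness of forward solutions for a `C¹` vector field. -/
theorem eqOn_Ici_of_hasDerivWithinAt [FiniteDimensional ℝ E] {F : E → E} (hF : ContDiff ℝ 1 F)
    {x y : ℝ → E} (hx : ∀ t, 0 ≤ t → HasDerivWithinAt x (F (x t)) (Ici 0) t)
    (hy : ∀ t, 0 ≤ t → HasDerivWithinAt y (F (y t)) (Ici 0) t) (h0 : x 0 = y 0) :
    EqOn x y (Ici 0) := by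
  have : ProperSpace E := FiniteDimensional.proper_real E
  intro T hT
  have hcont : ∀ z : ℝ → E, (∀ t, 0 ≤ t → HasDerivWithinAt z (F (z t)) (Ici 0) t) →
      ContinuousOn z (Icc 0 T) := fun z hz t ht =>
    (hz t ht.1).continuousWithinAt.mono Icc_subset_Ici_self
  -- On `[0, T]` both solutions stay in a common ball, on which a `C¹` field is Lipschitz.
  obtain ⟨B₁, hB₁⟩ := isCompact_Icc.exists_bound_of_continuousOn (hcont x hx)
  obtain ⟨B₂, hB₂⟩ := isCompact_Icc.exists_bound_of_continuousOn (hcont y hy)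
  obtain ⟨K, hK⟩ := (hF.contDiffOn
    (s := Metric.closedBall (0 : E) (max B₁ B₂))).exists_lipschitzOnWith
    one_ne_zero (convex_closedBall _ _) (isCompact_closedBall _ _)
  refine eqOn_of_hasDerivWithinAt_Icc hK (fun t ht => (hx t ht.1).mono Icc_subset_Ici_self)
    (fun t ht => (hy t ht.1).mono Icc_subset_Ici_self) (fun t ht => ?_) (fun t ht => ?_) h0
    ⟨hT, le_rfl⟩
  · exact mem_closedBall_zero_iff.2 ((hB₁ t ht).trans (le_max_left _ _))
  · exact mem_closedBall_zero_iff.2 ((hB₂ t ht).trans (le_max_right _ _))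

end ODE

/-! ### Lindblad generators in standard form -/

section LindbladForm

variable {A : Type*} [CStarAlgebra A] {κ : Type*}

/-- The generator `x ↦ i[h,x] + ∑ᵢ ½([Jᵢ†,x]Jᵢ + Jᵢ†[x,Jᵢ])`. -/
def lindbladOf (s : Finset κ) (h : A) (J : κ → A) : A →L[ℂ] A :=
  Complex.I • (ContinuousLinearMap.mul ℂ A h - (ContinuousLinearMap.mul ℂ A).flip h) +
  ∑ i ∈ s, (1 / 2 : ℂ) •
    ((ContinuousLinearMap.mul ℂ A).flip (J i) ∘L
        (ContinuousLinearMap.mul ℂ A (star (J i)) -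
          (ContinuousLinearMap.mul ℂ A).flip (star (J i))) +
      ContinuousLinearMap.mul ℂ A (star (J i)) ∘L
        ((ContinuousLinearMap.mul ℂ A).flip (J i) - ContinuousLinearMap.mul ℂ A (J i)))

lemma lindbladOf_apply (s : Finset κ) (h : A) (J : κ → A) (x : A) :
    lindbladOf s h J x = Complex.I • (h * x - x * h) + ∑ i ∈ s, (1 / 2 : ℂ) •
      ((star (J i) * x - x * star (J i)) * J i + star (J i) * (x * J i - J i * x)) := by
  simp [lindbladOf, mul_sub, sub_mul]

/-- The operator `-ih - ½∑ᵢ Jᵢ†Jᵢ`. -/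
def driftOf (s : Finset κ) (h : A) (J : κ → A) : A :=
  -(Complex.I • h) - (1 / 2 : ℂ) • ∑ i ∈ s, star (J i) * J i

/-- Subtracting `K† x + x K` leaves exactly `∑ Jᵢ† x Jᵢ`, and conjugation preserves positivity. -/
lemma isLindblad_lindbladOf (s : Finset κ) {h : A} (hh : IsSelfAdjoint h) (J : κ → A) :
    IsLindblad (lindbladOf s h J) (driftOf s h J) := by
  constructor
  · simp [lindbladOf_apply]
  · intro φ hφ a
    have e : lindbladOf s h J (star a * a) - star (driftOf s h J) * (star a * a) -
        star a * a * driftOf s h J = ∑ i ∈ s, star (J i) * (star a * a) * J i := by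
      rw [lindbladOf_apply, driftOf]
      simp only [star_sub, star_neg, star_smul, star_sum, star_mul, star_star, hh.star_eq,
        Complex.star_def, Complex.conj_I, map_div₀, map_one, map_ofNat, sub_mul, mul_sub,
        mul_neg, neg_smul, smul_mul_assoc, mul_smul_comm, Finset.sum_mul,
        Finset.mul_sum, smul_sub, neg_neg, Finset.smul_sum, smul_add, Finset.sum_add_distrib,
        Finset.sum_sub_distrib, mul_assoc]
      have : ∀ y : A, (1 / 2 : ℂ) • y + (1 / 2 : ℂ) • y = y := fun y => by
        rw [← add_smul]; norm_num
      simp only [← Finset.smul_sum]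
      nth_rewrite 3 [← this (∑ i ∈ s, star (J i) * (star a * (a * J i)))]
      abel
    rw [e, map_sum]
    exact Finset.sum_nonneg fun i _ => hφ.comp_conj a (J i)

lemma lindbladOf_sub_smul_one (s : Finset κ) (h : A) (J : κ → A) (x : A) (c : ℂ) :
    lindbladOf s h J (x - c • 1) = lindbladOf s h J x := by
  rw [map_sub, map_smul, show lindbladOf s h J 1 = 0 by simp [lindbladOf_apply], smul_zero,
    sub_zero]

/-- The Hamiltonian part is a derivation; each dissipator violates the Leibniz rule by
`[x,J]†[x,J]`. -/
lemma lindbladOf_sq (s : Finset κ) (h : A) (J : κ → A) {x : A} (hx : IsSelfAdjoint x) :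
    lindbladOf s h J (x ^ 2) = lindbladOf s h J x * x + x * lindbladOf s h J x +
      ∑ i ∈ s, star ⁅x, J i⁆ * ⁅x, J i⁆ := by
  have e : ∀ i, (1 / 2 : ℂ) •
      ((star (J i) * x ^ 2 - x ^ 2 * star (J i)) * J i + star (J i) * (x ^ 2 * J i - J i * x ^ 2))
      = (1 / 2 : ℂ) • ((star (J i) * x - x * star (J i)) * J i +
          star (J i) * (x * J i - J i * x)) * x +
        x * (1 / 2 : ℂ) • ((star (J i) * x - x * star (J i)) * J i +
          star (J i) * (x * J i - J i * x)) + star ⁅x, J i⁆ * ⁅x, J i⁆ := by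
    intro i
    have : ∀ y : A, y = (1 / 2 : ℂ) • y + (1 / 2 : ℂ) • y := fun y => by
      rw [← add_smul]; norm_num
    rw [this (star ⁅x, J i⁆ * ⁅x, J i⁆)]
    simp only [Ring.lie_def, star_sub, star_mul, hx.star_eq, smul_mul_assoc, mul_smul_comm,
      ← smul_add]
    congr 1
    noncomm_ring
  simp only [lindbladOf_apply, e, Finset.sum_add_distrib, Finset.sum_mul, Finset.mul_sum,
    add_mul, mul_add]
  have e2 : Complex.I • (h * x ^ 2 - x ^ 2 * h) = Complex.I • (h * x - x * h) * x +
      x * Complex.I • (h * x - x * h) := by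
    rw [smul_mul_assoc, mul_smul_comm, ← smul_add]
    congr 1
    noncomm_ring
  rw [e2]
  abel

lemma isSelfAdjoint_lindbladOf (s : Finset κ) {h : A} (hh : IsSelfAdjoint h) (J : κ → A) {x : A}
    (hx : IsSelfAdjoint x) : IsSelfAdjoint (lindbladOf s h J x) := by
  rw [IsSelfAdjoint, lindbladOf_apply]
  simp only [star_add, star_sum, star_smul, star_sub, star_mul, star_star, hx.star_eq, hh.star_eq,
    Complex.star_def, Complex.conj_I, map_div₀, map_one, map_ofNat]
  congr 1
  · rw [neg_smul, ← smul_neg, neg_sub]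
  · refine Finset.sum_congr rfl fun i _ => ?_
    congr 1
    noncomm_ring

end LindbladForm

/-! ### The mean-field equations on the states of one particle -/

namespace Model

open scoped Matrix.Norms.L2Operator

variable {d q : ℕ} (P : Model d q)

lemma linearIndependent_v : LinearIndependent ℂ P.v := by
  rw [Fintype.linearIndependent_iff]
  intro g hg β
  have := congrArg (fun x => (x * P.v β).trace) hg
  simpa [Finset.sum_mul, Matrix.trace_sum, P.v_orth] using this

/-- Orthonormality gives independence, and `d²` independent matrices span. -/
lemma sum_trace_smul_v (x : Matrix (Fin d) (Fin d) ℂ) :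
    ∑ α, (x * P.v α).trace • P.v α = x := by
  have hspan : Submodule.span ℂ (range P.v) = ⊤ := by
    apply P.linearIndependent_v.span_eq_top_of_card_eq_finrank'
    rw [Module.finrank_matrix]
    simp [sq]
  have hx : x ∈ Submodule.span ℂ (range P.v) := hspan ▸ Submodule.mem_top
  obtain ⟨g, rfl⟩ := (Submodule.mem_span_range_iff_exists_fun ℂ).1 hx
  refine Finset.sum_congr rfl fun α _ => ?_
  congr 1
  simp [Finset.sum_mul, Matrix.trace_sum, P.v_orth]

/-- The functional on one-particle matrices with values `m_α` at `v_α`. -/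
def dual (m : Fin (d ^ 2) → ℝ) : Matrix (Fin d) (Fin d) ℂ →ₗ[ℂ] ℂ :=
  ∑ α, (m α : ℂ) • (Matrix.traceLinearMap (Fin d) ℂ ℂ ∘ₗ LinearMap.mulRight ℂ (P.v α))

lemma dual_apply (m : Fin (d ^ 2) → ℝ) (x : Matrix (Fin d) (Fin d) ℂ) :
    P.dual m x = ∑ α, (m α : ℂ) * (x * P.v α).trace := by
  simp [dual]

lemma dual_v (m : Fin (d ^ 2) → ℝ) (α : Fin (d ^ 2)) : P.dual m (P.v α) = m α := by
  simp [dual_apply, P.v_orth]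

lemma eq_dual (φ : Matrix (Fin d) (Fin d) ℂ →ₗ[ℂ] ℂ) {m : Fin (d ^ 2) → ℝ}
    (h : ∀ α, φ (P.v α) = m α) : φ = P.dual m := by
  ext1 x
  rw [← P.sum_trace_smul_v x, map_sum, map_sum]
  simp only [map_smul, h, dual_v]

lemma continuous_dual_apply (x : Matrix (Fin d) (Fin d) ℂ) : Continuous fun m => P.dual m x := by
  simp only [dual_apply]
  fun_prop

/-- The one-particle Hamiltonian of the mean field `m`. -/
def mfHam (m : Fin (d ^ 2) → ℝ) : Matrix (Fin d) (Fin d) ℂ :=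
  ∑ β', ((P.ε β' : ℂ) + ∑ β, (P.h β β' + P.h β' β) * (m β : ℂ)) • P.v β'

lemma isSelfAdjoint_v (α : Fin (d ^ 2)) : IsSelfAdjoint (P.v α) := P.v_herm α

lemma isSelfAdjoint_mfHam (m : Fin (d ^ 2) → ℝ) : IsSelfAdjoint (P.mfHam m) := by
  rw [IsSelfAdjoint, mfHam]
  simp only [star_sum, star_smul, (P.isSelfAdjoint_v _).star_eq]
  refine Finset.sum_congr rfl fun β' _ => ?_
  congr 1
  simp only [Complex.star_def, map_add, map_sum, map_mul, Complex.conj_ofReal, ← P.h_herm]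
  simp only [add_comm]

/-- The jump matrices of the mean field `m`. -/
def mfJump (m : Fin (d ^ 2) → ℝ) (ℓ : Fin q) : Matrix (Fin d) (Fin d) ℂ :=
  (P.rate ℓ (P.delta ℓ m) : ℂ) • P.j ℓ

/-- The one-particle generator of the mean field `m`. -/
def mfGen (m : Fin (d ^ 2) → ℝ) : Matrix (Fin d) (Fin d) ℂ →L[ℂ] Matrix (Fin d) (Fin d) ℂ :=
  lindbladOf Finset.univ (P.mfHam m) (P.mfJump m)

lemma mfGen_apply (m : Fin (d ^ 2) → ℝ) (x : Matrix (Fin d) (Fin d) ℂ) :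
    P.mfGen m x = Complex.I • (P.mfHam m * x - x * P.mfHam m) +
      ∑ ℓ, ((P.rate ℓ (P.delta ℓ m) : ℝ) : ℂ) ^ 2 • P.localDissipator ℓ x := by
  rw [mfGen, lindbladOf_apply]
  congr 1
  refine Finset.sum_congr rfl fun ℓ _ => ?_
  rw [localDissipator, mfJump, smul_comm]
  congr 1
  simp only [star_smul, Complex.star_def, Complex.conj_ofReal, smul_mul_assoc, mul_smul_comm,
    ← smul_sub, smul_smul, ← smul_add, sq]

lemma dual_comm (m : Fin (d ^ 2) → ℝ) (β' α : Fin (d ^ 2)) :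
    P.dual m (P.v β' * P.v α - P.v α * P.v β') = ∑ γ, P.structCoeff β' α γ * (m γ : ℂ) := by
  simp only [dual_apply, structCoeff, mul_comm]

/-- This identifies the equations as a nonlinear one-particle Lindblad equation, in which the
Hamiltonian and the jump matrices depend on the current mean field; positivity arguments apply
through it. -/
lemma meanField_eq (m : Fin (d ^ 2) → ℝ) (α : Fin (d ^ 2)) :
    P.meanField m α = P.dual m (P.mfGen m (P.v α)) := by
  rw [mfGen_apply, map_add, map_smul, map_sum, meanField, ← mul_add, smul_eq_mul]
  congr 1
  · congr 1
    have : P.mfHam m * P.v α - P.v α * P.mfHam m =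
        ∑ β', ((P.ε β' : ℂ) + ∑ β, (P.h β β' + P.h β' β) * (m β : ℂ)) •
          (P.v β' * P.v α - P.v α * P.v β') := by
      simp only [mfHam, Finset.sum_mul, Finset.mul_sum, smul_mul_assoc, mul_smul_comm, smul_sub,
        Finset.sum_sub_distrib]
    rw [this, map_sum]
    simp only [map_smul, dual_comm, smul_eq_mul, add_mul, Finset.sum_add_distrib]
    congr 1
    · simp only [coeffA, Finset.sum_mul, Finset.mul_sum]
      rw [Finset.sum_comm]
      simp only [mul_assoc]
    · simp only [coeffB, Finset.sum_mul, Finset.mul_sum]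
      simp only [← Finset.sum_add_distrib]
      conv_lhs => enter [2, β]; rw [Finset.sum_comm]
      rw [Finset.sum_comm]
      refine Finset.sum_congr rfl fun β' _ => ?_
      rw [Finset.sum_comm]
      refine Finset.sum_congr rfl fun γ _ => Finset.sum_congr rfl fun β _ => ?_
      ring
  · refine Finset.sum_congr rfl fun ℓ _ => ?_
    rw [map_smul, dual_apply, smul_eq_mul, Finset.mul_sum]
    refine Finset.sum_congr rfl fun β _ => ?_
    rw [coeffM]
    ring

/-- The mean fields given by the states of one particle. -/
def stateSet : Set (Fin (d ^ 2) → ℝ) := {m | IsState (P.dual m)}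

lemma isClosed_stateSet : IsClosed P.stateSet := by
  have : P.stateSet = (⋂ a, {m | P.dual m (star a * a) ∈ Ici (0 : ℂ)}) ∩
      {m | P.dual m 1 = 1} := by
    ext m
    simp only [mem_inter_iff, mem_iInter]
    exact ⟨fun h => ⟨h.pos, h.map_one⟩, fun h => ⟨h.1, h.2⟩⟩
  rw [this]
  exact (isClosed_iInter fun a => isClosed_Ici.preimage (P.continuous_dual_apply _)).inter
    (isClosed_eq (P.continuous_dual_apply _) continuous_const)

/-- A bound on the mean fields of states. -/
def fieldBound : ℝ := ∑ α, ‖P.v α‖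

lemma norm_v_le_fieldBound (α : Fin (d ^ 2)) : ‖P.v α‖ ≤ P.fieldBound :=
  Finset.single_le_sum (f := fun α => ‖P.v α‖) (fun _ _ => norm_nonneg _) (Finset.mem_univ α)

lemma fieldBound_nonneg : 0 ≤ P.fieldBound := Finset.sum_nonneg fun _ _ => norm_nonneg _

lemma norm_le_of_mem_stateSet {m : Fin (d ^ 2) → ℝ} (hm : m ∈ P.stateSet) :
    ‖m‖ ≤ P.fieldBound := by
  rw [pi_norm_le_iff_of_nonneg P.fieldBound_nonneg]
  intro α
  have := (IsState.norm_apply_le hm (P.v α)).trans (P.norm_v_le_fieldBound α)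
  rwa [dual_v, Complex.norm_real] at this

/-- The real vector field of the mean-field equations. -/
def field (m : Fin (d ^ 2) → ℝ) (α : Fin (d ^ 2)) : ℝ := (P.meanField m α).re

/-- The generator sends the hermitian `v_α` to a hermitian matrix, where a state is real. -/
lemma meanField_eq_field {m : Fin (d ^ 2) → ℝ} (hm : m ∈ P.stateSet) (α : Fin (d ^ 2)) :
    P.meanField m α = P.field m α := by
  apply Complex.ext
  · rfl
  · rw [Complex.ofReal_im, meanField_eq]
    exact IsPositive.im_eq_zero hm.pos
      (isSelfAdjoint_lindbladOf _ (P.isSelfAdjoint_mfHam m) _ (P.isSelfAdjoint_v α))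

lemma contDiff_rate (ℓ : Fin q) : ContDiff ℝ 1 (P.rate ℓ) := contDiff_tsum_mul_pow (P.c_summable ℓ)

lemma contDiff_rate_delta (ℓ : Fin q) : ContDiff ℝ 1 fun m => P.rate ℓ (P.delta ℓ m) := by
  refine (P.contDiff_rate ℓ).comp ?_
  unfold delta
  fun_prop

lemma contDiff_field : ContDiff ℝ 1 P.field := by
  rw [contDiff_pi]
  intro α
  have hr := P.contDiff_rate_delta
  have h2 : ∀ ℓ, ContDiff ℝ 1 fun m : Fin (d ^ 2) → ℝ =>
      ((P.rate ℓ (P.delta ℓ m) : ℝ) : ℂ) := fun ℓ => Complex.ofRealCLM.contDiff.comp (hr ℓ)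
  have h3 : ∀ β, ContDiff ℝ 1 fun m : Fin (d ^ 2) → ℝ => (m β : ℂ) := fun β =>
    Complex.ofRealCLM.contDiff.comp (contDiff_apply ℝ ℝ β)
  have h : ContDiff ℝ 1 fun m => P.meanField m α := by
    unfold meanField
    fun_prop
  exact Complex.reCLM.contDiff.comp h

lemma continuous_mfDrift :
    Continuous fun m => driftOf Finset.univ (P.mfHam m) (P.mfJump m) := by
  have hr : ∀ ℓ, Continuous fun m => P.rate ℓ (P.delta ℓ m) := fun ℓ =>
    (P.contDiff_rate_delta ℓ).continuous
  unfold driftOf mfHam mfJump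
  fun_prop

/-- Subtangentiality of the mean-field vector field to the set of states. -/
lemma exists_mem_stateSet_near : ∃ C : ℝ, ∀ m ∈ P.stateSet, ∀ δ : ℝ, 0 < δ →
    ∃ m' ∈ P.stateSet, ‖m + δ • P.field m - m'‖ ≤ C * δ ^ 2 := by
  -- The error of an Euler step depends on the drift, which varies with `m`; compactness bounds it
  -- uniformly over all states.
  obtain ⟨B, hB⟩ := (isCompact_closedBall (0 : Fin (d ^ 2) → ℝ)
    P.fieldBound).exists_bound_of_continuousOn P.continuous_mfDrift.continuousOn
  refine ⟨2 * B ^ 2 * P.fieldBound, fun m hm δ hδ => ?_⟩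
  have hm' : IsState (P.dual m) := hm
  have hK := hB m (mem_closedBall_zero_iff.2 (P.norm_le_of_mem_stateSet hm))
  obtain ⟨ψ, hψ, hle⟩ := (isLindblad_lindbladOf Finset.univ (P.isSelfAdjoint_mfHam m)
    (P.mfJump m)).exists_isState (φ := hm'.toCLM) hm' hδ
  -- The coordinates of the nearby state `ψ` in the basis `v`.
  let m' : Fin (d ^ 2) → ℝ := fun α => (ψ (P.v α)).re
  have hψv : ∀ α, ψ (P.v α) = m' α := fun α =>
    Complex.ext rfl (hψ.pos.im_eq_zero (P.isSelfAdjoint_v α))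
  refine ⟨m', ?_, ?_⟩
  · rw [stateSet, mem_ofPred_eq, ← P.eq_dual (ψ : Matrix (Fin d) (Fin d) ℂ →ₗ[ℂ] ℂ) hψv]
    exact hψ
  · have hb := P.fieldBound_nonneg
    rw [pi_norm_le_iff_of_nonneg (by positivity)]
    intro α
    have h1 : ((m α + δ * P.field m α - m' α : ℝ) : ℂ) =
        (hm'.toCLM + δ • hm'.toCLM.comp (P.mfGen m) - ψ) (P.v α) := by
      simp only [sub_apply, add_apply, smul_apply, ContinuousLinearMap.comp_apply,
        IsState.toCLM_apply, dual_v, hψv, ← meanField_eq, P.meanField_eq_field hm,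
        Complex.real_smul]
      push_cast
      ring
    have h2 : ‖(m + δ • P.field m - m') α‖ =
        ‖(hm'.toCLM + δ • hm'.toCLM.comp (P.mfGen m) - ψ) (P.v α)‖ := by
      rw [← h1, Complex.norm_real]; rfl
    rw [h2]
    refine (ContinuousLinearMap.le_opNorm _ _).trans ?_
    have h3 : ‖hm'.toCLM + δ • hm'.toCLM.comp (P.mfGen m) - ψ‖ ≤ 2 * B ^ 2 * δ ^ 2 := by
      refine hle.trans ?_
      gcongr
    calc _ ≤ 2 * B ^ 2 * δ ^ 2 * P.fieldBound :=
          mul_le_mul h3 (P.norm_v_le_fieldBound α) (norm_nonneg _) (by positivity)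
      _ = _ := by ring

/-- Global existence: states remain states under the mean-field equations. -/
theorem exists_solution {m₀ : Fin (d ^ 2) → ℝ} (h₀ : m₀ ∈ P.stateSet) :
    ∃ m : ℝ → Fin (d ^ 2) → ℝ, P.IsMeanFieldSolution m₀ m ∧ ∀ t, 0 ≤ t → m t ∈ P.stateSet := by
  obtain ⟨C, hC⟩ := P.exists_mem_stateSet_near
  obtain ⟨m, hm0, hm⟩ := exists_forall_mem_hasDerivWithinAt_Ici P.contDiff_field
    P.isClosed_stateSet (fun s hs => P.norm_le_of_mem_stateSet hs) hC h₀
  refine ⟨m, ⟨hm0, fun t ht α => ?_⟩, fun t ht => (hm t ht).1⟩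
  rw [P.meanField_eq_field (hm t ht).1]
  exact ((hasDerivWithinAt_pi.1 (hm t ht).2) α).ofReal_comp

/-- Taking real parts needs no membership in `stateSet`, so uniqueness will hold among all real
solutions. -/
lemma IsMeanFieldSolution.hasDerivWithinAt {P : Model d q} {m₀ : Fin (d ^ 2) → ℝ}
    {m : ℝ → Fin (d ^ 2) → ℝ} (hm : P.IsMeanFieldSolution m₀ m) {t : ℝ} (ht : 0 ≤ t) :
    HasDerivWithinAt m (P.field (m t)) (Ici 0) t := by
  rw [hasDerivWithinAt_pi]
  intro α
  exact (Complex.reCLM.hasFDerivAt.comp_hasDerivWithinAt t (hm.2 t ht α))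

theorem eqOn_of_isMeanFieldSolution {m₀ : Fin (d ^ 2) → ℝ} {m m' : ℝ → Fin (d ^ 2) → ℝ}
    (hm : P.IsMeanFieldSolution m₀ m) (hm' : P.IsMeanFieldSolution m₀ m') :
    EqOn m' m (Ici 0) :=
  eqOn_Ici_of_hasDerivWithinAt P.contDiff_field (fun _ ht => hm'.hasDerivWithinAt ht)
    (fun _ ht => hm.hasDerivWithinAt ht) (hm'.1.trans hm.1.symm)

end Model

/-! ### Averages of one-site operators -/

section Averages

variable {d : ℕ}

/-- A bound on the norm of the operators `x⁽ᵏ⁾`. -/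
def siteNorm (x : Matrix (Fin d) (Fin d) ℂ) : ℝ := √(siteBound x * (d * d))

lemma siteNorm_nonneg (x : Matrix (Fin d) (Fin d) ℂ) : 0 ≤ siteNorm x := Real.sqrt_nonneg _

lemma norm_site_le (k : ℕ) (x : Matrix (Fin d) (Fin d) ℂ) : ‖site k x‖ ≤ siteNorm x := by
  change ‖siteCLM k x‖ ≤ _
  unfold siteCLM
  exact LinearMap.mkContinuous_norm_le _ (Real.sqrt_nonneg _) _

lemma average_add (N : ℕ) (x y : Matrix (Fin d) (Fin d) ℂ) :
    average N (x + y) = average N x + average N y := by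
  simp [average, Finset.sum_add_distrib]

lemma average_smul (N : ℕ) (c : ℂ) (x : Matrix (Fin d) (Fin d) ℂ) :
    average N (c • x) = c • average N x := by
  simp [average, Finset.smul_sum, smul_comm c]

/-- The average as a linear map of the one-site matrix. -/
def averageLin (N : ℕ) : Matrix (Fin d) (Fin d) ℂ →ₗ[ℂ] QuasiLocal d where
  toFun := average N
  map_add' := average_add N
  map_smul' := average_smul N

lemma average_sum {κ : Type*} (s : Finset κ) (N : ℕ) (x : κ → Matrix (Fin d) (Fin d) ℂ) :
    average N (∑ i ∈ s, x i) = ∑ i ∈ s, average N (x i) :=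
  map_sum (averageLin N) x s

lemma star_average (N : ℕ) (x : Matrix (Fin d) (Fin d) ℂ) :
    star (average N x) = average N (star x) := by
  simp [average, map_star]

lemma isSelfAdjoint_average (N : ℕ) {x : Matrix (Fin d) (Fin d) ℂ} (hx : IsSelfAdjoint x) :
    IsSelfAdjoint (average N x) := by
  rw [IsSelfAdjoint, star_average, hx.star_eq]

lemma norm_average_le (N : ℕ) (x : Matrix (Fin d) (Fin d) ℂ) : ‖average N x‖ ≤ siteNorm x := by
  rw [average, norm_smul, norm_inv, Complex.norm_natCast]
  have h : ‖∑ k ∈ Finset.range N, site k x‖ ≤ N * siteNorm x := by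
    refine (norm_sum_le_of_le _ fun k _ => norm_site_le k x).trans ?_
    simp
  rcases N.eq_zero_or_pos with rfl | hN
  · simpa using siteNorm_nonneg x
  · rw [inv_mul_le_iff₀ (by positivity)]
    exact h

lemma sum_site_eq {N : ℕ} (hN : 1 ≤ N) (x : Matrix (Fin d) (Fin d) ℂ) :
    ∑ k ∈ Finset.range N, site k x = (N : ℂ) • average N x := by
  rw [average, smul_inv_smul₀]
  exact_mod_cast (by lia : N ≠ 0)

lemma average_one {N : ℕ} (hN : 1 ≤ N) : average N (1 : Matrix (Fin d) (Fin d) ℂ) = 1 := by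
  have : (N : ℂ) ≠ 0 := by exact_mod_cast (by lia : N ≠ 0)
  simp only [average, map_one, Finset.sum_const, Finset.card_range, ← Nat.cast_smul_eq_nsmul ℂ]
  rw [inv_smul_smul₀ this]

/-- Only the summand at the same site fails to commute. -/
lemma lie_site_average {N k : ℕ} (hk : k < N) (x y : Matrix (Fin d) (Fin d) ℂ) :
    ⁅site k x, average N y⁆ = (N : ℂ)⁻¹ • site k ⁅x, y⁆ := by
  have h : ∀ l, site k x * site l y - site l y * site k x =
      if k = l then site k ⁅x, y⁆ else 0 := fun l => by
    split_ifs with h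
    · subst h
      simp [Ring.lie_def]
    · rw [(site_commute h x y).eq, sub_self]
  rw [Ring.lie_def, average, mul_smul_comm, smul_mul_assoc, ← smul_sub, Finset.mul_sum,
    Finset.sum_mul, ← Finset.sum_sub_distrib, Finset.sum_congr rfl fun l _ => h l,
    Finset.sum_ite_eq, if_pos (Finset.mem_range.2 hk)]

lemma sum_lie_eq {A κ : Type*} [Ring A] (s : Finset κ) (x : κ → A) (b : A) :
    ⁅∑ i ∈ s, x i, b⁆ = ∑ i ∈ s, ⁅x i, b⁆ := by
  simp only [Ring.lie_def, Finset.sum_mul, Finset.mul_sum, Finset.sum_sub_distrib]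

lemma smul_lie_eq {A : Type*} [Ring A] [Algebra ℂ A] (c : ℂ) (x b : A) :
    ⁅c • x, b⁆ = c • ⁅x, b⁆ := by
  simp only [Ring.lie_def, smul_mul_assoc, mul_smul_comm, smul_sub]

/-- The source of all `1/N` errors: of the `N²` pairs of sites only the `N` diagonal ones
contribute. -/
lemma lie_average_average (N : ℕ) (x y : Matrix (Fin d) (Fin d) ℂ) :
    ⁅average N x, average N y⁆ = (N : ℂ)⁻¹ • average N ⁅x, y⁆ := by
  have h : ⁅average N x, average N y⁆ =
      (N : ℂ)⁻¹ • ∑ k ∈ Finset.range N, ⁅site k x, average N y⁆ := by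
    rw [← sum_lie_eq, ← smul_lie_eq]; rfl
  rw [h, Finset.sum_congr rfl fun k hk => lie_site_average (Finset.mem_range.1 hk) x y,
    ← Finset.smul_sum]
  rfl

end Averages

namespace Model

variable {d q : ℕ} (P : Model d q)

/-! ### The generator on averages -/

/-- The one-site part of the Hamiltonian. -/
def siteHam : Matrix (Fin d) (Fin d) ℂ := ∑ α, (P.ε α : ℂ) • P.v α

/-- The one-site matrix of the collective operator `Δ_ℓ`. -/
def deltaMatrix (ℓ : Fin q) : Matrix (Fin d) (Fin d) ℂ := ∑ α, (P.r ℓ α : ℂ) • P.v α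

lemma deltaOp_eq (N : ℕ) (ℓ : Fin q) : P.deltaOp N ℓ = average N (P.deltaMatrix ℓ) := by
  simp only [deltaOp, deltaMatrix, average_sum, average_smul, mOp]

lemma isSelfAdjoint_mOp (N : ℕ) (α : Fin (d ^ 2)) : IsSelfAdjoint (P.mOp N α) :=
  isSelfAdjoint_average N (P.isSelfAdjoint_v α)

lemma isSelfAdjoint_deltaOp (N : ℕ) (ℓ : Fin q) : IsSelfAdjoint (P.deltaOp N ℓ) := by
  simp only [IsSelfAdjoint, deltaOp, star_sum, star_smul, (P.isSelfAdjoint_mOp N _).star_eq,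
    Complex.star_def, Complex.conj_ofReal]

lemma isSelfAdjoint_rateOp (N : ℕ) (ℓ : Fin q) : IsSelfAdjoint (P.rateOp N ℓ) :=
  isSelfAdjoint_powSeries (P.c ℓ) (P.isSelfAdjoint_deltaOp N ℓ)

/-- `N` times a polynomial in averages: this factor cancels the `1/N` of one commutator, so the
Hamiltonian drives averages at rate of order one. -/
lemma hamiltonian_eq {N : ℕ} (hN : 1 ≤ N) : P.hamiltonian N = (N : ℂ) • (average N P.siteHam +
    ∑ α, ∑ β, P.h α β • (P.mOp N α * P.mOp N β)) := by
  have hN0 : (N : ℂ) ≠ 0 := by exact_mod_cast (by lia : N ≠ 0)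
  rw [hamiltonian, smul_add]
  congr 1
  · rw [← sum_site_eq hN]
    simp only [siteHam, map_sum, map_smul]
  · have : ∑ k ∈ Finset.range N, ∑ j ∈ Finset.range N, ∑ α, ∑ β,
        P.h α β • (site k (P.v α) * site j (P.v β)) =
        ∑ α, ∑ β, P.h α β • (((N : ℂ) • P.mOp N α) * ((N : ℂ) • P.mOp N β)) := by
      simp only [mOp, ← sum_site_eq hN, Finset.sum_mul_sum, Finset.smul_sum]
      rw [Finset.sum_congr rfl fun k _ => Finset.sum_comm, Finset.sum_comm]
      refine Finset.sum_congr rfl fun α _ => ?_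
      rw [Finset.sum_congr rfl fun k _ => Finset.sum_comm, Finset.sum_comm]
    rw [this]
    simp only [Finset.smul_sum]
    refine Finset.sum_congr rfl fun α _ => Finset.sum_congr rfl fun β _ => ?_
    rw [smul_mul_smul_comm, smul_smul, smul_smul, smul_smul]
    congr 1
    field_simp

lemma isSelfAdjoint_hamiltonian {N : ℕ} (hN : 1 ≤ N) : IsSelfAdjoint (P.hamiltonian N) := by
  have h1 : star (average N P.siteHam) = average N P.siteHam := by
    rw [star_average]
    simp only [siteHam, star_sum, star_smul, (P.isSelfAdjoint_v _).star_eq, Complex.star_def,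
      Complex.conj_ofReal]
  have h2 : star (∑ α, ∑ β, P.h α β • (P.mOp N α * P.mOp N β)) =
      ∑ α, ∑ β, P.h α β • (P.mOp N α * P.mOp N β) := by
    simp only [star_sum, star_smul, star_mul, (P.isSelfAdjoint_mOp N _).star_eq,
      Complex.star_def, ← P.h_herm]
    exact Finset.sum_comm
  rw [IsSelfAdjoint, P.hamiltonian_eq hN, star_smul, star_add, h1, h2, Complex.star_def,
    Complex.conj_natCast]

lemma lindblad_eq (N : ℕ) : P.lindblad N =
    lindbladOf (Finset.univ ×ˢ Finset.range N) (P.hamiltonian N)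
      (fun p => P.jump N p.1 p.2) := by
  ext1 x
  rw [lindblad_apply, lindbladOf_apply, Finset.sum_product]
  simp only [Finset.smul_sum]

lemma isLindblad_lindblad {N : ℕ} (hN : 1 ≤ N) : ∃ K, IsLindblad (P.lindblad N) K :=
  ⟨_, P.lindblad_eq N ▸ isLindblad_lindbladOf _ (P.isSelfAdjoint_hamiltonian hN) _⟩

/-- The Hamiltonian part of the generator on `m_α`. -/
lemma lie_hamiltonian_mOp {N : ℕ} (hN : 1 ≤ N) (α : Fin (d ^ 2)) :
    ⁅P.hamiltonian N, P.mOp N α⁆ = average N ⁅P.siteHam, P.v α⁆ +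
      ∑ β, ∑ γ, P.h β γ • (P.mOp N β * average N ⁅P.v γ, P.v α⁆ +
        average N ⁅P.v β, P.v α⁆ * P.mOp N γ) := by
  have hN0 : (N : ℂ) ≠ 0 := by exact_mod_cast (by lia : N ≠ 0)
  rw [P.hamiltonian_eq hN]
  simp only [smul_lie_eq, add_lie_eq, sum_lie_eq, mul_lie_eq, mOp, lie_average_average,
    mul_smul_comm, smul_mul_assoc, ← smul_add, smul_comm (P.h _ _), ← Finset.smul_sum]
  rw [smul_inv_smul₀ hN0]

/-- Separates the commutator with the one-site factor `s` of the jump, which yields the local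
dissipator, from the commutator with the collective rate `g`. -/
lemma dissipator_split {A : Type*} [CStarAlgebra A] (s g o : A) (hg : IsSelfAdjoint g) :
    (star (s * g) * o - o * star (s * g)) * (s * g) + star (s * g) * (o * (s * g) - s * g * o) =
      g * (⁅star s, o⁆ * s - star s * ⁅s, o⁆) * g +
        (⁅g, o⁆ * (star s * s) * g - g * (star s * s) * ⁅g, o⁆) := by
  simp only [star_mul, hg.star_eq, Ring.lie_def]
  noncomm_ring

/-- The dissipative part of the generator on `m_α`. -/
lemma sum_dissipator_mOp {N : ℕ} (hN : 1 ≤ N) (ℓ : Fin q) (α : Fin (d ^ 2)) :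
    ∑ k ∈ Finset.range N, (1 / 2 : ℂ) •
      ((star (P.jump N ℓ k) * P.mOp N α - P.mOp N α * star (P.jump N ℓ k)) * P.jump N ℓ k +
        star (P.jump N ℓ k) * (P.mOp N α * P.jump N ℓ k - P.jump N ℓ k * P.mOp N α)) =
      P.rateOp N ℓ * average N (P.localDissipator ℓ (P.v α)) * P.rateOp N ℓ +
        (N / 2 : ℂ) • (⁅P.rateOp N ℓ, P.mOp N α⁆ * average N (star (P.j ℓ) * P.j ℓ) *
          P.rateOp N ℓ - P.rateOp N ℓ * average N (star (P.j ℓ) * P.j ℓ) *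
            ⁅P.rateOp N ℓ, P.mOp N α⁆) := by
  have hN0 : (N : ℂ) ≠ 0 := by exact_mod_cast (by lia : N ≠ 0)
  have h1 : ∀ k ∈ Finset.range N, (1 / 2 : ℂ) •
      ((star (P.jump N ℓ k) * P.mOp N α - P.mOp N α * star (P.jump N ℓ k)) * P.jump N ℓ k +
        star (P.jump N ℓ k) * (P.mOp N α * P.jump N ℓ k - P.jump N ℓ k * P.mOp N α)) =
      (N : ℂ)⁻¹ • (P.rateOp N ℓ * site k (P.localDissipator ℓ (P.v α)) * P.rateOp N ℓ) +
        (1 / 2 : ℂ) • (⁅P.rateOp N ℓ, P.mOp N α⁆ * site k (star (P.j ℓ) * P.j ℓ) *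
          P.rateOp N ℓ - P.rateOp N ℓ * site k (star (P.j ℓ) * P.j ℓ) *
            ⁅P.rateOp N ℓ, P.mOp N α⁆) := fun k hk => by
    have hk' := Finset.mem_range.1 hk
    have e : site k (P.localDissipator ℓ (P.v α)) = (1 / 2 : ℂ) •
        (site k ⁅star (P.j ℓ), P.v α⁆ * site k (P.j ℓ) -
          star (site k (P.j ℓ)) * site k ⁅P.j ℓ, P.v α⁆) := by
      rw [← map_star, ← map_mul, ← map_mul, ← map_sub, ← map_smul, localDissipator]
      congr 2
      simp only [Ring.lie_def]
      noncomm_ring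
    rw [jump, dissipator_split _ _ _ (P.isSelfAdjoint_rateOp N ℓ), smul_add, ← map_star, mOp,
      lie_site_average hk', lie_site_average hk', e, map_mul, map_star]
    congr 1
    simp only [smul_mul_assoc, mul_smul_comm, ← smul_sub]
    rw [smul_comm]
  rw [Finset.sum_congr rfl h1, Finset.sum_add_distrib, ← Finset.smul_sum, ← Finset.smul_sum,
    ← Finset.sum_mul, ← Finset.mul_sum, Finset.sum_sub_distrib, ← Finset.sum_mul,
    ← Finset.mul_sum, ← Finset.sum_mul, ← Finset.mul_sum, sum_site_eq hN, sum_site_eq hN]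
  simp only [smul_mul_assoc, mul_smul_comm, ← smul_sub, smul_smul]
  rw [inv_mul_cancel₀ hN0, one_smul]
  congr 2
  ring

/-- The mean-field generator on `v_α`, arranged like `lie_hamiltonian_mOp`. -/
lemma lie_mfHam_v (m : Fin (d ^ 2) → ℝ) (α : Fin (d ^ 2)) :
    P.mfHam m * P.v α - P.v α * P.mfHam m = ⁅P.siteHam, P.v α⁆ +
      ∑ β, ∑ γ, P.h β γ • ((m β : ℂ) • ⁅P.v γ, P.v α⁆ + (m γ : ℂ) • ⁅P.v β, P.v α⁆) := by
  have e : P.mfHam m = P.siteHam +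
      ∑ β, ∑ γ, P.h β γ • ((m β : ℂ) • P.v γ + (m γ : ℂ) • P.v β) := by
    simp only [mfHam, siteHam, add_smul, Finset.sum_add_distrib, Finset.sum_smul, smul_add,
      smul_smul, add_mul]
    rw [Finset.sum_comm]
  rw [← Ring.lie_def, e]
  simp only [add_lie_eq, sum_lie_eq, smul_lie_eq]

end Model

namespace Model

variable {d q : ℕ} (P : Model d q)

/-! ### Approximation of collective operators by scalars, uniformly in all parameters -/

/-- A particle number, a mean field and a state; estimates uniform in these data are expressed
by `=O[⊤]`. -/
structure Config where
  N : ℕ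
  one_le : 1 ≤ N
  m : Fin (d ^ 2) → ℝ
  mem : m ∈ P.stateSet
  φ : QuasiLocal d →ₗ[ℂ] ℂ
  isState : IsState φ

variable {P}

/-- The variance of the averages around the mean field, plus `1/N`. -/
def Config.err (i : P.Config) : ℝ :=
  ∑ α, (i.φ ((P.mOp i.N α - (i.m α : ℂ) • 1) ^ 2)).re + (i.N : ℝ)⁻¹

lemma Config.isSelfAdjoint (i : P.Config) (α : Fin (d ^ 2)) :
    IsSelfAdjoint (P.mOp i.N α - (i.m α : ℂ) • 1) := by
  rw [IsSelfAdjoint, star_sub, (P.isSelfAdjoint_mOp _ _).star_eq, star_smul, star_one,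
    Complex.star_def, Complex.conj_ofReal]

lemma Config.variance_nonneg (i : P.Config) (α : Fin (d ^ 2)) :
    0 ≤ (i.φ ((P.mOp i.N α - (i.m α : ℂ) • 1) ^ 2)).re :=
  i.isState.pos.sq_re_nonneg (i.isSelfAdjoint α)

lemma Config.variance_le_err (i : P.Config) (α : Fin (d ^ 2)) :
    (i.φ ((P.mOp i.N α - (i.m α : ℂ) • 1) ^ 2)).re ≤ i.err := by
  have h1 := Finset.single_le_sum (fun β _ => i.variance_nonneg β) (Finset.mem_univ α)
  have h2 : 0 ≤ (i.N : ℝ)⁻¹ := by positivity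
  exact h1.trans (le_add_of_nonneg_right h2)

lemma Config.inv_le_err (i : P.Config) : (i.N : ℝ)⁻¹ ≤ i.err :=
  le_add_of_nonneg_left (Finset.sum_nonneg fun α _ => i.variance_nonneg α)

lemma Config.err_nonneg (i : P.Config) : 0 ≤ i.err :=
  le_trans (by positivity) i.inv_le_err

lemma Config.inv_le_one (i : P.Config) : (i.N : ℝ)⁻¹ ≤ 1 :=
  inv_le_one_of_one_le₀ (by exact_mod_cast i.one_le)

/-- Families that are small in mean square. -/
def Negligible (Y : P.Config → QuasiLocal d) : Prop :=
  (fun i => (i.φ (star (Y i) * Y i)).re) =O[⊤] Config.err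

/-- Uniformly bounded families. -/
def Bounded (Y : P.Config → QuasiLocal d) : Prop := Y =O[⊤] fun _ => (1 : ℝ)

/-- Families of norm `O(1/N)`. -/
def Small (Y : P.Config → QuasiLocal d) : Prop := Y =O[⊤] fun i => (i.N : ℝ)⁻¹

/-- The collective operators `Y` are close to the scalars `y` in mean square. -/
def Approx (Y : P.Config → QuasiLocal d) (y : P.Config → ℂ) : Prop :=
  Negligible fun i => Y i - y i • 1

lemma isBigO_top_of_le {ι E : Type*} [SeminormedAddCommGroup E] {f : ι → E} {g : ι → ℝ} (C : ℝ)
    (h : ∀ i, ‖f i‖ ≤ C * g i) : f =O[⊤] g :=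
  isBigO_of_le' ⊤ (c := |C|) fun i => (h i).trans (by
    rw [Real.norm_eq_abs, ← abs_mul]; exact le_abs_self _)

lemma negligible_of_le {Y : P.Config → QuasiLocal d} (C : ℝ)
    (h : ∀ i : P.Config, (i.φ (star (Y i) * Y i)).re ≤ C * i.err) : Negligible Y :=
  isBigO_top_of_le C fun i => by
    rw [Real.norm_of_nonneg (i.isState.pos.re_nonneg _)]; exact h i

lemma Negligible.congr {Y Z : P.Config → QuasiLocal d} (h : Negligible Y) (e : ∀ i, Y i = Z i) :
    Negligible Z :=
  funext e ▸ h

lemma Approx.congr {Y Z : P.Config → QuasiLocal d} {y z : P.Config → ℂ} (h : Approx Y y)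
    (e : ∀ i, Y i = Z i) (e' : ∀ i, y i = z i) : Approx Z z :=
  funext e ▸ funext e' ▸ h

lemma Negligible.exists_le {Y : P.Config → QuasiLocal d} (h : Negligible Y) :
    ∃ C, 0 ≤ C ∧ ∀ i : P.Config, (i.φ (star (Y i) * Y i)).re ≤ C * i.err := by
  obtain ⟨C, hC, h'⟩ := IsBigO.exists_nonneg h
  refine ⟨C, hC, fun i => (Real.le_norm_self _).trans ?_⟩
  have := isBigOWith_top.1 h' i
  rwa [Real.norm_of_nonneg i.err_nonneg] at this

lemma Bounded.exists_le {Y : P.Config → QuasiLocal d} (h : Bounded Y) :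
    ∃ C, 0 ≤ C ∧ ∀ i : P.Config, ‖Y i‖ ≤ C := by
  obtain ⟨C, hC, h'⟩ := IsBigO.exists_nonneg h
  exact ⟨C, hC, fun i => by simpa using isBigOWith_top.1 h' i⟩

lemma bounded_of_le {Y : P.Config → QuasiLocal d} (C : ℝ) (h : ∀ i, ‖Y i‖ ≤ C) : Bounded Y :=
  isBigO_top_of_le C fun i => by rw [mul_one]; exact h i

lemma Small.exists_le {Y : P.Config → QuasiLocal d} (h : Small Y) :
    ∃ C, 0 ≤ C ∧ ∀ i : P.Config, ‖Y i‖ ≤ C * (i.N : ℝ)⁻¹ := by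
  obtain ⟨C, hC, h'⟩ := IsBigO.exists_nonneg h
  refine ⟨C, hC, fun i => ?_⟩
  have := isBigOWith_top.1 h' i
  rwa [Real.norm_of_nonneg (by positivity)] at this

lemma Bounded.mul {Y Z : P.Config → QuasiLocal d} (hY : Bounded Y) (hZ : Bounded Z) :
    Bounded fun i => Y i * Z i := by
  simpa [Bounded] using IsBigO.mul hY hZ

lemma Bounded.mul_small {Y Z : P.Config → QuasiLocal d} (hY : Bounded Y) (hZ : Small Z) :
    Small fun i => Y i * Z i := by
  simpa [Small] using IsBigO.mul hY hZ

lemma Small.negligible {Y : P.Config → QuasiLocal d} (h : Small Y) : Negligible Y := by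
  obtain ⟨C, hC, hY⟩ := h.exists_le
  refine negligible_of_le (C ^ 2) fun i => ?_
  have h0 : 0 ≤ (i.N : ℝ)⁻¹ := by positivity
  calc (i.φ (star (Y i) * Y i)).re ≤ ‖Y i‖ ^ 2 := i.isState.re_star_mul_self_le _
    _ ≤ (C * (i.N : ℝ)⁻¹) ^ 2 := by gcongr; exact hY i
    _ = C ^ 2 * ((i.N : ℝ)⁻¹ * (i.N : ℝ)⁻¹) := by ring
    _ ≤ C ^ 2 * (i.err * 1) := by
        gcongr
        · exact i.err_nonneg
        · exact i.inv_le_err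
        · exact i.inv_le_one
    _ = C ^ 2 * i.err := by ring

lemma Negligible.add {Y Z : P.Config → QuasiLocal d} (hY : Negligible Y) (hZ : Negligible Z) :
    Negligible fun i => Y i + Z i := by
  obtain ⟨C, hC, hY⟩ := hY.exists_le
  obtain ⟨D, hD, hZ⟩ := hZ.exists_le
  refine negligible_of_le (2 * C + 2 * D) fun i => (i.isState.pos.add_le _ _).trans ?_
  linarith [hY i, hZ i]

/-- The elements with `φ(Y†Y) = 0` form a left ideal; this is its quantitative form. -/
lemma Negligible.mul_left {B Y : P.Config → QuasiLocal d} (hB : Bounded B) (hY : Negligible Y) :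
    Negligible fun i => B i * Y i := by
  obtain ⟨C, hC, hB⟩ := hB.exists_le
  obtain ⟨D, hD, hY⟩ := hY.exists_le
  refine negligible_of_le (C ^ 2 * D) fun i => (i.isState.pos.mul_left_le _ _).trans ?_
  calc ‖B i‖ ^ 2 * (i.φ (star (Y i) * Y i)).re ≤ C ^ 2 * (D * i.err) := by
        gcongr
        · exact i.isState.pos.re_nonneg _
        · exact hB i
        · exact hY i
    _ = _ := by ring

lemma Negligible.smul {b : P.Config → ℂ} {Y : P.Config → QuasiLocal d} {C : ℝ}
    (hb : ∀ i, ‖b i‖ ≤ C) (hY : Negligible Y) : Negligible fun i => b i • Y i := by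
  have := hY.mul_left (B := fun i => b i • 1) (bounded_of_le C fun i => by
    have := i.isState.nontrivial
    rw [norm_smul, norm_one, mul_one]; exact hb i)
  simpa only [smul_mul_assoc, one_mul] using this

lemma Approx.add {Y Z : P.Config → QuasiLocal d} {y z : P.Config → ℂ} (hY : Approx Y y)
    (hZ : Approx Z z) : Approx (fun i => Y i + Z i) fun i => y i + z i := by
  have := Negligible.add hY hZ
  refine this.congr fun i => ?_
  rw [add_smul, add_sub_add_comm]

lemma Approx.add_small {Y Z : P.Config → QuasiLocal d} {y : P.Config → ℂ} (hY : Approx Y y)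
    (hZ : Small Z) : Approx (fun i => Y i + Z i) y := by
  have := Negligible.add hY hZ.negligible
  refine this.congr fun i => ?_
  rw [sub_add_eq_add_sub]

lemma Approx.const_smul {Y : P.Config → QuasiLocal d} {y : P.Config → ℂ} (c : ℂ)
    (hY : Approx Y y) : Approx (fun i => c • Y i) fun i => c * y i := by
  have := Negligible.smul (b := fun _ => c) (fun _ => le_rfl) hY
  refine this.congr fun i => ?_
  rw [smul_sub, smul_smul]

lemma Approx.sum {κ : Type*} (s : Finset κ) {Y : κ → P.Config → QuasiLocal d}
    {y : κ → P.Config → ℂ} (h : ∀ k ∈ s, Approx (Y k) (y k)) :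
    Approx (fun i => ∑ k ∈ s, Y k i) fun i => ∑ k ∈ s, y k i := by
  classical
  induction s using Finset.induction_on with
  | empty =>
    refine negligible_of_le 0 fun i => ?_
    simp
  | insert a s ha ih =>
    have := (h a (Finset.mem_insert_self a s)).add
      (ih fun k hk => h k (Finset.mem_insert_of_mem hk))
    simpa only [Finset.sum_insert ha] using this

/-- `YZ - yz = Y (Z - z) + z (Y - y)`, with bounded factors on the left of both differences. -/
lemma Approx.mul {Y Z : P.Config → QuasiLocal d} {y z : P.Config → ℂ} (hY : Approx Y y)
    (hZ : Approx Z z) (hYb : Bounded Y) {C : ℝ} (hz : ∀ i, ‖z i‖ ≤ C) :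
    Approx (fun i => Y i * Z i) fun i => y i * z i := by
  have := (Negligible.mul_left hYb hZ).add (Negligible.smul hz hY)
  refine this.congr fun i => ?_
  simp only [mul_sub, smul_sub, mul_smul_comm, mul_one, smul_smul, mul_comm (z i)]
  abel

/-! ### Averages and rate functions -/

lemma approx_mOp (α : Fin (d ^ 2)) :
    Approx (fun i : P.Config => P.mOp i.N α) fun i => (i.m α : ℂ) :=
  negligible_of_le 1 fun i => by
    rw [(i.isSelfAdjoint α).star_eq, ← sq, one_mul]
    exact i.variance_le_err α

lemma approx_average (x : Matrix (Fin d) (Fin d) ℂ) :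
    Approx (fun i : P.Config => average i.N x) fun i => P.dual i.m x := by
  have h := Approx.sum Finset.univ fun α (_ : α ∈ Finset.univ) =>
    (approx_mOp (P := P) α).const_smul (x * P.v α).trace
  have e : ∀ i : P.Config, average i.N x = ∑ α, (x * P.v α).trace • P.mOp i.N α := fun i => by
    conv_lhs => rw [← P.sum_trace_smul_v x, average_sum]
    simp only [average_smul, mOp]
  simpa only [e, dual_apply, mul_comm] using h

lemma bounded_average (x : Matrix (Fin d) (Fin d) ℂ) :
    Bounded fun i : P.Config => average i.N x :=
  bounded_of_le (siteNorm x) fun i => norm_average_le i.N x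

/-- States are contractive, so membership of `m` in `stateSet` gives uniformity. -/
lemma exists_norm_dual_le (x : Matrix (Fin d) (Fin d) ℂ) :
    ∃ C, ∀ i : P.Config, ‖P.dual i.m x‖ ≤ C := by
  open scoped Matrix.Norms.L2Operator in
  exact ⟨‖x‖, fun i => IsState.norm_apply_le i.mem x⟩

lemma norm_lie_average_le (i : P.Config) (x y : Matrix (Fin d) (Fin d) ℂ) :
    ‖⁅average i.N x, average i.N y⁆‖ ≤ siteNorm ⁅x, y⁆ * (i.N : ℝ)⁻¹ := by
  rw [lie_average_average, norm_smul, norm_inv, Complex.norm_natCast, mul_comm]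
  gcongr
  exact norm_average_le _ _

lemma norm_lie_lie_average_le (i : P.Config) (x y z : Matrix (Fin d) (Fin d) ℂ) :
    ‖⁅⁅average i.N x, average i.N y⁆, average i.N z⁆‖ ≤
      siteNorm ⁅⁅x, y⁆, z⁆ * ((i.N : ℝ)⁻¹ * (i.N : ℝ)⁻¹) := by
  rw [lie_average_average, smul_lie_eq, norm_smul, norm_inv, Complex.norm_natCast]
  have := norm_lie_average_le i ⁅x, y⁆ z
  calc (i.N : ℝ)⁻¹ * _ ≤ (i.N : ℝ)⁻¹ * (siteNorm ⁅⁅x, y⁆, z⁆ * (i.N : ℝ)⁻¹) := by gcongr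
    _ = _ := by ring

lemma delta_eq_dual (ℓ : Fin q) (m : Fin (d ^ 2) → ℝ) :
    (P.delta ℓ m : ℂ) = P.dual m (P.deltaMatrix ℓ) := by
  simp [delta, deltaMatrix, dual_v]

/-- A radius containing all values of the collective operators. -/
lemma exists_radius (ℓ : Fin q) : ∃ R : ℝ, 1 ≤ R ∧
    ∀ i : P.Config, ‖P.deltaOp i.N ℓ‖ ≤ R ∧ |P.delta ℓ i.m| ≤ R := by
  obtain ⟨C, hC⟩ := exists_norm_dual_le (P := P) (P.deltaMatrix ℓ)
  refine ⟨max 1 (max (siteNorm (P.deltaMatrix ℓ)) C), le_max_left _ _, fun i => ⟨?_, ?_⟩⟩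
  · rw [deltaOp_eq]
    exact (norm_average_le _ _).trans ((le_max_left _ _).trans (le_max_right _ _))
  · have := hC i
    rw [← delta_eq_dual, Complex.norm_real] at this
    exact this.trans ((le_max_right _ _).trans (le_max_right _ _))

lemma bounded_rateOp (ℓ : Fin q) : Bounded fun i : P.Config => P.rateOp i.N ℓ := by
  obtain ⟨R, hR, h⟩ := exists_radius (P := P) ℓ
  refine bounded_of_le (majorant (P.c ℓ) R) fun i => ?_
  have := i.isState.nontrivial
  exact norm_powSeries_le (P.c_summable ℓ) hR (h i).1

lemma approx_deltaOp (ℓ : Fin q) :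
    Approx (fun i : P.Config => P.deltaOp i.N ℓ) fun i => (P.delta ℓ i.m : ℂ) := by
  simpa only [deltaOp_eq, delta_eq_dual] using approx_average (P := P) (P.deltaMatrix ℓ)

lemma approx_rateOp (ℓ : Fin q) :
    Approx (fun i : P.Config => P.rateOp i.N ℓ) fun i => (P.rate ℓ (P.delta ℓ i.m) : ℂ) := by
  obtain ⟨R, hR, h⟩ := exists_radius (P := P) ℓ
  have h1 : ∀ i : P.Config, ∃ g : QuasiLocal d,
      P.rateOp i.N ℓ - (P.rate ℓ (P.delta ℓ i.m) : ℂ) • 1 =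
        g * (P.deltaOp i.N ℓ - (P.delta ℓ i.m : ℂ) • 1) ∧ ‖g‖ ≤ majorant (P.c ℓ) R := fun i => by
    have := i.isState.nontrivial
    exact exists_powSeries_sub_factor (P.c_summable ℓ) hR (h i).1 (h i).2
  choose g hg hgn using h1
  refine (Negligible.mul_left (bounded_of_le _ hgn) (approx_deltaOp ℓ)).congr fun i => ?_
  rw [hg]

lemma exists_norm_rate_le (ℓ : Fin q) :
    ∃ C, ∀ i : P.Config, ‖(P.rate ℓ (P.delta ℓ i.m) : ℂ)‖ ≤ C := by
  obtain ⟨R, hR, h⟩ := exists_radius (P := P) ℓ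
  obtain ⟨C, hC⟩ := isCompact_Icc.exists_bound_of_continuousOn (s := Icc (-R) R)
    (P.contDiff_rate ℓ).continuous.continuousOn
  exact ⟨C, fun i => by rw [Complex.norm_real]; exact hC _ (abs_le.1 (h i).2)⟩

lemma exists_norm_lie_rateOp_le (ℓ : Fin q) : ∃ S : ℝ, 0 ≤ S ∧
    ∀ (i : P.Config) (a : QuasiLocal d),
      ‖⁅P.rateOp i.N ℓ, a⁆‖ ≤ S * ‖⁅P.deltaOp i.N ℓ, a⁆‖ ∧
      ∀ b : QuasiLocal d, ‖⁅⁅P.rateOp i.N ℓ, a⁆, b⁆‖ ≤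
        S * (‖⁅⁅P.deltaOp i.N ℓ, a⁆, b⁆‖ + ‖⁅P.deltaOp i.N ℓ, a⁆‖ * ‖⁅P.deltaOp i.N ℓ, b⁆‖) := by
  obtain ⟨R, hR, h⟩ := exists_radius (P := P) ℓ
  refine ⟨majorant (P.c ℓ) R, ?_, fun i a => ?_⟩
  · exact tsum_nonneg fun n => by positivity
  · have := i.isState.nontrivial
    exact ⟨norm_powSeries_lie_le (P.c_summable ℓ) hR (h i).1 a,
      norm_powSeries_lie_lie_le (P.c_summable ℓ) hR (h i).1 a⟩

lemma small_lie_rateOp_average (ℓ : Fin q) (x : Matrix (Fin d) (Fin d) ℂ) :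
    Small fun i : P.Config => ⁅P.rateOp i.N ℓ, average i.N x⁆ := by
  obtain ⟨S, hS, h⟩ := exists_norm_lie_rateOp_le (P := P) ℓ
  refine isBigO_top_of_le (S * siteNorm ⁅P.deltaMatrix ℓ, x⁆) fun i => ((h i _).1).trans ?_
  rw [mul_assoc, deltaOp_eq]
  gcongr
  exact norm_lie_average_le i _ _

lemma isBigO_lie_lie_rateOp_average (ℓ : Fin q) (x y : Matrix (Fin d) (Fin d) ℂ) :
    (fun i : P.Config => ⁅⁅P.rateOp i.N ℓ, average i.N x⁆, average i.N y⁆) =O[⊤]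
      fun i => (i.N : ℝ)⁻¹ * (i.N : ℝ)⁻¹ := by
  obtain ⟨S, hS, h⟩ := exists_norm_lie_rateOp_le (P := P) ℓ
  refine isBigO_top_of_le (S * (siteNorm ⁅⁅P.deltaMatrix ℓ, x⁆, y⁆ +
    siteNorm ⁅P.deltaMatrix ℓ, x⁆ * siteNorm ⁅P.deltaMatrix ℓ, y⁆)) fun i =>
      ((h i _).2 _).trans ?_
  rw [deltaOp_eq]
  have h1 := norm_lie_lie_average_le i (P.deltaMatrix ℓ) x y
  have h2 := norm_lie_average_le i (P.deltaMatrix ℓ) x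
  have h3 := norm_lie_average_le i (P.deltaMatrix ℓ) y
  have h4 := mul_le_mul h2 h3 (norm_nonneg _)
    (mul_nonneg (siteNorm_nonneg _) (by positivity))
  rw [mul_assoc]
  gcongr
  linarith

lemma norm_lie_symm {A : Type*} [NormedRing A] (a b : A) : ‖⁅a, b⁆‖ = ‖⁅b, a⁆‖ := by
  rw [Ring.lie_def, Ring.lie_def, norm_sub_rev]

/-- The bound for commutators of the rate holds against any operator. Applied to the outer rate it
replaces `Γ(Δ)` by the average `Δ`, which reduces to the preceding estimate. -/
lemma isBigO_lie_lie_rateOp_rateOp (ℓ : Fin q) (x : Matrix (Fin d) (Fin d) ℂ) :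
    (fun i : P.Config => ⁅⁅P.rateOp i.N ℓ, average i.N x⁆, P.rateOp i.N ℓ⁆) =O[⊤]
      fun i => (i.N : ℝ)⁻¹ * (i.N : ℝ)⁻¹ := by
  obtain ⟨S, hS, h⟩ := exists_norm_lie_rateOp_le (P := P) ℓ
  refine IsBigO.trans (isBigO_top_of_le (g := fun i : P.Config =>
    ‖⁅⁅P.rateOp i.N ℓ, average i.N x⁆, average i.N (P.deltaMatrix ℓ)⁆‖) S fun i => ?_)
    (isBigO_lie_lie_rateOp_average ℓ x (P.deltaMatrix ℓ)).norm_left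
  rw [norm_lie_symm, ← deltaOp_eq, norm_lie_symm _ (P.deltaOp i.N ℓ)]
  exact (h i _).1

lemma small_natCast_smul {Y : P.Config → QuasiLocal d}
    (h : Y =O[⊤] fun i => (i.N : ℝ)⁻¹ * (i.N : ℝ)⁻¹) : Small fun i => (i.N / 2 : ℂ) • Y i := by
  obtain ⟨C, hC, h'⟩ := IsBigO.exists_nonneg h
  refine isBigO_top_of_le C fun i => ?_
  have hN : (0 : ℝ) < i.N := by exact_mod_cast i.one_le
  have h1 := isBigOWith_top.1 h' i
  rw [Real.norm_of_nonneg (by positivity)] at h1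
  rw [norm_smul, norm_div, Complex.norm_natCast, Complex.norm_ofNat]
  calc (i.N : ℝ) / 2 * ‖Y i‖ ≤ i.N * (C * ((i.N : ℝ)⁻¹ * (i.N : ℝ)⁻¹)) := by
        gcongr
        linarith
    _ = C * (i.N : ℝ)⁻¹ := by field_simp

/-- The left side vanishes if everything commutes; the right side exhibits a further commutator in
each term. For `c = O(1/N)` all three are of order `N⁻²`. -/
lemma comm_remainder_eq {A : Type*} [Ring A] (c n g : A) :
    c * n * g - g * n * c = c * ⁅n, g⁆ + ⁅c, g⁆ * n + g * ⁅c, n⁆ := by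
  simp only [Ring.lie_def]
  noncomm_ring

lemma small_dissipator_remainder (ℓ : Fin q) (x y : Matrix (Fin d) (Fin d) ℂ) :
    Small fun i : P.Config => (i.N / 2 : ℂ) • (⁅P.rateOp i.N ℓ, average i.N x⁆ * average i.N y *
      P.rateOp i.N ℓ - P.rateOp i.N ℓ * average i.N y * ⁅P.rateOp i.N ℓ, average i.N x⁆) := by
  simp only [comm_remainder_eq]
  apply small_natCast_smul
  refine IsBigO.add (IsBigO.add ?_ ?_) ?_
  · have h : Small fun i : P.Config => ⁅average i.N y, P.rateOp i.N ℓ⁆ := by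
      refine (IsBigO.neg_left (small_lie_rateOp_average ℓ y)).congr_left fun i => ?_
      simp only [Ring.lie_def, neg_sub]
    exact IsBigO.mul (small_lie_rateOp_average ℓ x) h
  · simpa using IsBigO.mul (isBigO_lie_lie_rateOp_rateOp ℓ x) (bounded_average y)
  · simpa using IsBigO.mul (bounded_rateOp ℓ) (isBigO_lie_lie_rateOp_average ℓ x y)

/-- The generator on the averages is close to the mean-field vector field. -/
lemma approx_lindblad_mOp (α : Fin (d ^ 2)) :
    Approx (fun i : P.Config => P.lindblad i.N (P.mOp i.N α)) fun i => P.meanField i.m α := by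
  have hH : Approx (fun i : P.Config => Complex.I • ⁅P.hamiltonian i.N, P.mOp i.N α⁆)
      fun i => Complex.I * P.dual i.m (P.mfHam i.m * P.v α - P.v α * P.mfHam i.m) := by
    refine Approx.const_smul _ ?_
    have h1 : ∀ β γ, Approx (fun i : P.Config => P.mOp i.N β * average i.N ⁅P.v γ, P.v α⁆)
        fun i => (i.m β : ℂ) * P.dual i.m ⁅P.v γ, P.v α⁆ := fun β γ => by
      obtain ⟨C, hC⟩ := exists_norm_dual_le (P := P) ⁅P.v γ, P.v α⁆
      exact (approx_mOp β).mul (approx_average _) (bounded_average (P.v β)) hC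
    have h2 : ∀ β γ, Approx (fun i : P.Config => average i.N ⁅P.v β, P.v α⁆ * P.mOp i.N γ)
        fun i => P.dual i.m ⁅P.v β, P.v α⁆ * (i.m γ : ℂ) := fun β γ => by
      obtain ⟨C, hC⟩ := exists_norm_dual_le (P := P) (P.v γ)
      simp only [dual_v] at hC
      exact (approx_average _).mul (approx_mOp γ) (bounded_average _) hC
    have h3 := (approx_average (P := P) ⁅P.siteHam, P.v α⁆).add
      (Approx.sum Finset.univ fun β (_ : β ∈ Finset.univ) =>
        Approx.sum Finset.univ fun γ (_ : γ ∈ Finset.univ) =>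
          ((h1 β γ).add (h2 β γ)).const_smul (P.h β γ))
    refine h3.congr (fun i => (P.lie_hamiltonian_mOp i.one_le α).symm) fun i => ?_
    rw [lie_mfHam_v]
    simp only [map_add, map_sum, map_smul, smul_eq_mul, mul_comm (P.dual _ _)]
  have hD : ∀ ℓ, Approx (fun i : P.Config =>
      P.rateOp i.N ℓ * average i.N (P.localDissipator ℓ (P.v α)) * P.rateOp i.N ℓ)
      fun i => (P.rate ℓ (P.delta ℓ i.m) : ℂ) ^ 2 *
        P.dual i.m (P.localDissipator ℓ (P.v α)) := fun ℓ => by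
    obtain ⟨C, hC⟩ := exists_norm_dual_le (P := P) (P.localDissipator ℓ (P.v α))
    obtain ⟨C', hC'⟩ := exists_norm_rate_le (P := P) ℓ
    have h1 := ((approx_rateOp (P := P) ℓ).mul (approx_rateOp ℓ) (bounded_rateOp ℓ) hC').mul
      (approx_average (P.localDissipator ℓ (P.v α)))
      ((bounded_rateOp ℓ).mul (bounded_rateOp ℓ)) hC
    -- `ΓxΓ = ΓΓx - Γ[Γ,x]`, and the commutator is `O(1/N)`.
    have h2 := (bounded_rateOp ℓ).mul_small
      (small_lie_rateOp_average (P := P) ℓ (P.localDissipator ℓ (P.v α)))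
    have h3 := h1.add_small (IsBigO.neg_left h2)
    refine h3.congr (fun i => ?_) fun i => by rw [sq]
    have e : P.rateOp i.N ℓ * P.rateOp i.N ℓ * average i.N (P.localDissipator ℓ (P.v α)) +
        -(P.rateOp i.N ℓ * ⁅P.rateOp i.N ℓ, average i.N (P.localDissipator ℓ (P.v α))⁆) =
        P.rateOp i.N ℓ * average i.N (P.localDissipator ℓ (P.v α)) * P.rateOp i.N ℓ := by
      rw [Ring.lie_def]
      noncomm_ring
    exact e
  have h := hH.add (Approx.sum Finset.univ fun ℓ (_ : ℓ ∈ Finset.univ) =>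
    (hD ℓ).add_small (small_dissipator_remainder ℓ (P.v α) (star (P.j ℓ) * P.j ℓ)))
  refine h.congr (fun i => ?_) fun i => ?_
  · rw [lindblad_apply, ← Ring.lie_def]
    simp only [Finset.smul_sum, P.sum_dissipator_mOp i.one_le]
    rfl
  · rw [meanField_eq, mfGen_apply]
    simp only [map_add, map_sum, map_smul, smul_eq_mul]

end Model

namespace Model

variable {d q : ℕ} {P : Model d q}

/-! ### The derivative of the variance -/

/-- The operator whose expectation is the derivative of the variance. -/
def varianceDeriv (i : P.Config) (α : Fin (d ^ 2)) : QuasiLocal d :=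
  P.lindblad i.N ((P.mOp i.N α - (i.m α : ℂ) • 1) ^ 2) -
    (2 * P.field i.m α : ℂ) • (P.mOp i.N α - (i.m α : ℂ) • 1)

/-- Either the one-site factor is hit, where one of the `N` summands of the average contributes, or
the rate is hit, which is a commutator of collective operators. -/
lemma exists_norm_lie_jump_le (ℓ : Fin q) (α : Fin (d ^ 2)) : ∃ C : ℝ, 0 ≤ C ∧
    ∀ (i : P.Config), ∀ k < i.N,
      ‖⁅P.mOp i.N α - (i.m α : ℂ) • 1, P.jump i.N ℓ k⁆‖ ≤ C * (i.N : ℝ)⁻¹ := by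
  obtain ⟨S, hS, hS'⟩ := (bounded_rateOp (P := P) ℓ).exists_le
  obtain ⟨T, hT, hT'⟩ := (small_lie_rateOp_average (P := P) ℓ (P.v α)).exists_le
  have h0 := siteNorm_nonneg (P.j ℓ)
  have h1 := siteNorm_nonneg ⁅P.j ℓ, P.v α⁆
  refine ⟨siteNorm (P.j ℓ) * T + siteNorm ⁅P.j ℓ, P.v α⁆ * S, by positivity, fun i k hk => ?_⟩
  have e : ⁅P.mOp i.N α - (i.m α : ℂ) • 1, P.jump i.N ℓ k⁆ =
      -(site k (P.j ℓ) * ⁅P.rateOp i.N ℓ, average i.N (P.v α)⁆ +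
        ⁅site k (P.j ℓ), average i.N (P.v α)⁆ * P.rateOp i.N ℓ) := by
    rw [← mul_lie_eq, ← jump, Ring.lie_def, Ring.lie_def, sub_mul, mul_sub, smul_mul_assoc,
      mul_smul_comm, one_mul, mul_one, mOp]
    abel
  have h2 : ‖⁅site k (P.j ℓ), average i.N (P.v α)⁆‖ ≤
      (i.N : ℝ)⁻¹ * siteNorm ⁅P.j ℓ, P.v α⁆ := by
    rw [lie_site_average hk, norm_smul, norm_inv, Complex.norm_natCast]
    gcongr
    exact norm_site_le _ _
  rw [e, norm_neg]
  calc _ ≤ ‖site k (P.j ℓ)‖ * ‖⁅P.rateOp i.N ℓ, average i.N (P.v α)⁆‖ +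
        ‖⁅site k (P.j ℓ), average i.N (P.v α)⁆‖ * ‖P.rateOp i.N ℓ‖ :=
        (norm_add_le _ _).trans (add_le_add (norm_mul_le _ _) (norm_mul_le _ _))
    _ ≤ siteNorm (P.j ℓ) * (T * (i.N : ℝ)⁻¹) +
        ((i.N : ℝ)⁻¹ * siteNorm ⁅P.j ℓ, P.v α⁆) * S := by
        gcongr
        · exact norm_site_le _ _
        · exact hT' i
        · exact hS' i
    _ = _ := by ring

/-- The Leibniz defect of `lindbladOf_sq`: `qN` terms of size `N⁻²`. -/
lemma small_sum_lie_jump (α : Fin (d ^ 2)) : Small fun i : P.Config =>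
    ∑ p ∈ (Finset.univ : Finset (Fin q)) ×ˢ Finset.range i.N,
      star ⁅P.mOp i.N α - (i.m α : ℂ) • 1, P.jump i.N p.1 p.2⁆ *
        ⁅P.mOp i.N α - (i.m α : ℂ) • 1, P.jump i.N p.1 p.2⁆ := by
  choose C hC0 hC using fun ℓ => exists_norm_lie_jump_le (P := P) ℓ α
  refine isBigO_top_of_le (∑ ℓ, C ℓ ^ 2) fun i => ?_
  have hN : (0 : ℝ) < i.N := by exact_mod_cast i.one_le
  rw [Finset.sum_product]
  have h1 : ∀ ℓ ∈ (Finset.univ : Finset (Fin q)), ‖∑ k ∈ Finset.range i.N,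
      star ⁅P.mOp i.N α - (i.m α : ℂ) • 1, P.jump i.N ℓ k⁆ *
        ⁅P.mOp i.N α - (i.m α : ℂ) • 1, P.jump i.N ℓ k⁆‖ ≤ C ℓ ^ 2 * (i.N : ℝ)⁻¹ := by
    intro ℓ _
    calc _ ≤ ∑ k ∈ Finset.range i.N, (C ℓ * (i.N : ℝ)⁻¹) ^ 2 := by
          refine norm_sum_le_of_le _ fun k hk => ?_
          rw [CStarRing.norm_star_mul_self, ← sq]
          have := hC ℓ i k (Finset.mem_range.1 hk)
          gcongr
      _ = C ℓ ^ 2 * (i.N : ℝ)⁻¹ := by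
          rw [Finset.sum_const, Finset.card_range, nsmul_eq_mul]
          field_simp
  refine (norm_sum_le_of_le _ h1).trans ?_
  rw [Finset.sum_mul]

/-- The main estimate: the derivative of the variance is bounded by the variance plus `1/N`. -/
theorem exists_varianceDeriv_le (P : Model d q) : ∃ C : ℝ, 0 < C ∧ ∀ i : P.Config,
    (i.φ (∑ α, varianceDeriv i α)).re ≤ C * i.err := by
  choose A hA0 hA using fun α => (approx_lindblad_mOp (P := P) α).exists_le
  choose B hB0 hB using fun α => (small_sum_lie_jump (P := P) α).exists_le
  -- `A` bounds the mean square of `Y`, the inner `1` that of `X`, and `B` the Leibniz defect; the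
  -- outer `1` keeps the constant positive even for an empty index set.
  refine ⟨1 + ∑ α, (A α + 1 + B α), ?_, fun i => ?_⟩
  · have : 0 ≤ ∑ α, (A α + 1 + B α) :=
      Finset.sum_nonneg fun α _ => by linarith [hA0 α, hB0 α]
    linarith
  have key : ∀ α, (i.φ (varianceDeriv i α)).re ≤ (A α + 1 + B α) * i.err := fun α => by
    set X := P.mOp i.N α - (i.m α : ℂ) • (1 : QuasiLocal d) with hX
    set Y := P.lindblad i.N (P.mOp i.N α) - (P.meanField i.m α) • (1 : QuasiLocal d) with hY
    have hXsa : IsSelfAdjoint X := i.isSelfAdjoint α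
    have hYsa : IsSelfAdjoint Y := by
      have h1 : IsSelfAdjoint (P.lindblad i.N (P.mOp i.N α)) := by
        rw [lindblad_eq]
        exact isSelfAdjoint_lindbladOf _ (P.isSelfAdjoint_hamiltonian i.one_le) _
          (P.isSelfAdjoint_mOp _ _)
      rw [IsSelfAdjoint, hY, P.meanField_eq_field i.mem, star_sub, h1.star_eq, star_smul, star_one,
        Complex.star_def, Complex.conj_ofReal]
    have hLX : P.lindblad i.N X = Y + (P.meanField i.m α) • (1 : QuasiLocal d) := by
      rw [hX, hY, lindblad_eq, lindbladOf_sub_smul_one, sub_add_cancel]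
    set D := ∑ p ∈ (Finset.univ : Finset (Fin q)) ×ˢ Finset.range i.N,
      star ⁅X, P.jump i.N p.1 p.2⁆ * ⁅X, P.jump i.N p.1 p.2⁆ with hD
    -- The term `2 f_α X` caused by the motion of `m(t)` cancels the scalar part of the generator on
    -- `X`.
    have e : varianceDeriv i α = (Y * X + X * Y) + D := by
      have h1 : P.lindblad i.N (X ^ 2) =
          P.lindblad i.N X * X + X * P.lindblad i.N X + D := by
        rw [lindblad_eq]
        exact lindbladOf_sq _ _ _ hXsa
      rw [varianceDeriv, ← hX, h1, hLX, P.meanField_eq_field i.mem]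
      simp only [add_mul, mul_add, smul_mul_assoc, mul_smul_comm, one_mul, mul_one, two_mul,
        add_smul]
      abel
    rw [e, map_add, Complex.add_re]
    have h1 := (le_abs_self _).trans (i.isState.pos.abs_re_anticomm_le hYsa hXsa)
    have h2 : (i.φ (star Y * Y)).re ≤ A α * i.err := hA α i
    have h3 : (i.φ (X ^ 2)).re ≤ i.err := i.variance_le_err α
    have h4 : (i.φ D).re ≤ B α * i.err := by
      refine (Complex.re_le_norm _).trans ((i.isState.norm_apply_le D).trans ((hB α i).trans ?_))
      gcongr
      · exact hB0 α
      · exact i.inv_le_err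
    linarith
  rw [map_sum, Complex.re_sum]
  calc _ ≤ ∑ α, (A α + 1 + B α) * i.err := Finset.sum_le_sum fun α _ => key α
    _ ≤ (1 + ∑ α, (A α + 1 + B α)) * i.err := by
        rw [← Finset.sum_mul]
        exact mul_le_mul_of_nonneg_right (by linarith) i.err_nonneg

end Model

/-! ### States of the quasi-local algebra -/

lemma QState.isState {d : ℕ} (ω : QState d) : IsState ω.toLin :=
  ⟨fun a => Complex.nonneg_iff.2 ⟨ω.re_nonneg a, (ω.im_eq_zero a).symm⟩, ω.map_one⟩

namespace Model

variable {d q : ℕ} (P : Model d q)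

lemma tendsto_average {ω : QState d} {m₀ : Fin (d ^ 2) → ℝ}
    (h : ∀ α, Tendsto (fun N : ℕ => ω.toLin (P.mOp N α)) atTop (𝓝 (m₀ α : ℂ)))
    (x : Matrix (Fin d) (Fin d) ℂ) :
    Tendsto (fun N : ℕ => ω.toLin (average N x)) atTop (𝓝 (P.dual m₀ x)) := by
  have h1 := tendsto_finsetSum Finset.univ fun α (_ : α ∈ Finset.univ) =>
    (h α).const_mul (x * P.v α).trace
  rw [dual_apply]
  simp only [mul_comm (x * _).trace] at h1
  refine h1.congr fun N => ?_
  conv_rhs => rw [← P.sum_trace_smul_v x, average_sum, map_sum]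
  simp only [average_smul, map_smul, smul_eq_mul, mOp, mul_comm]

-- For `N ≥ 1` the map `x ↦ ω(average N x)` is a one-particle state, and states are closed under
-- limits. At `N = 0` the average is `0`, so positivity holds for every `N` but normalisation only
-- eventually.
open scoped Matrix.Norms.L2Operator in
lemma mem_stateSet_of_tendsto {ω : QState d} {m₀ : Fin (d ^ 2) → ℝ}
    (h : ∀ α, Tendsto (fun N : ℕ => ω.toLin (P.mOp N α)) atTop (𝓝 (m₀ α : ℂ))) :
    m₀ ∈ P.stateSet := by
  refine ⟨fun a => ?_, ?_⟩
  · refine isClosed_Ici.mem_of_tendsto (P.tendsto_average h (star a * a))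
      (Eventually.of_forall fun N => ?_)
    rw [average, map_smul, map_sum, smul_eq_mul]
    have hN : (0 : ℂ) ≤ (N : ℂ)⁻¹ := by
      rw [← Complex.ofReal_natCast, ← Complex.ofReal_inv, Complex.zero_le_real]
      positivity
    have hsum : (0 : ℂ) ≤ ∑ k ∈ Finset.range N, ω.toLin (site k (star a * a)) := by
      refine Finset.sum_nonneg fun k _ => ?_
      rw [map_mul, map_star]
      exact ω.isState.pos _
    exact mul_nonneg hN hsum
  · refine tendsto_nhds_unique (P.tendsto_average h 1) (tendsto_const_nhds.congr' ?_)
    filter_upwards [eventually_ge_atTop 1] with N hN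
    rw [average_one hN, ω.map_one]

/-! ### Evolution of the total variance -/

/-- The time-evolved state. -/
def evolvedState (ω : QState d) (N : ℕ) (t : ℝ) : QuasiLocal d →L[ℂ] ℂ :=
  ω.isState.toCLM.comp (P.evolve N t)

lemma evolvedState_apply (ω : QState d) (N : ℕ) (t : ℝ) (O : QuasiLocal d) :
    P.evolvedState ω N t O = P.expect ω N t O := rfl

lemma isState_evolvedState (ω : QState d) {N : ℕ} (hN : 1 ≤ N) {t : ℝ} (ht : 0 ≤ t) :
    IsState (P.evolvedState ω N t : QuasiLocal d →ₗ[ℂ] ℂ) := by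
  obtain ⟨K, hK⟩ := P.isLindblad_lindblad hN
  exact hK.isState_exp (φ := ω.isState.toCLM) ω.isState ht

lemma hasDerivAt_expect (ω : QState d) (N : ℕ) (O : QuasiLocal d) (t : ℝ) :
    HasDerivAt (fun s => P.expect ω N s O) (P.expect ω N t (P.lindblad N O)) t := by
  let R : (QuasiLocal d →L[ℂ] QuasiLocal d) →L[ℂ] ℂ :=
    ω.isState.toCLM.comp (ContinuousLinearMap.apply ℂ (QuasiLocal d) O)
  exact (R.restrictScalars ℝ).hasFDerivAt.comp_hasDerivAt t
    (hasDerivAt_exp_real_smul (P.lindblad N) t)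

lemma expect_one (ω : QState d) {N : ℕ} (hN : 1 ≤ N) {t : ℝ} (ht : 0 ≤ t) :
    P.expect ω N t 1 = 1 :=
  (P.isState_evolvedState ω hN ht).map_one

lemma totalVariance_eq (ω : QState d) (m : ℝ → Fin (d ^ 2) → ℝ) (N : ℕ) (t : ℝ) :
    P.totalVariance ω m N t =
      ∑ α, (P.evolvedState ω N t ((P.mOp N α - (m t α : ℂ) • 1) ^ 2)).re := by
  simp only [totalVariance, Complex.re_sum, Algebra.algebraMap_eq_smul_one, evolvedState_apply]

lemma sq_sub_smul_one {A : Type*} [Ring A] [Algebra ℂ A] (x : A) (c : ℂ) :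
    (x - c • 1) ^ 2 = x ^ 2 - (2 * c) • x + (c ^ 2) • 1 := by
  simp only [sq, sub_mul, mul_sub, smul_mul_assoc, mul_smul_comm, one_mul, mul_one, smul_sub,
    smul_smul, two_mul, add_smul]
  abel

lemma hasDerivWithinAt_totalVariance (ω : QState d) {m₀ : Fin (d ^ 2) → ℝ}
    {m : ℝ → Fin (d ^ 2) → ℝ} (hm : P.IsMeanFieldSolution m₀ m)
    (hmem : ∀ t, 0 ≤ t → m t ∈ P.stateSet) {N : ℕ} (hN : 1 ≤ N) {t : ℝ} (ht : 0 ≤ t) :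
    HasDerivWithinAt (P.totalVariance ω m N)
      (P.evolvedState ω N t (∑ α, varianceDeriv
        ⟨N, hN, m t, hmem t ht, P.evolvedState ω N t, P.isState_evolvedState ω hN ht⟩ α)).re
      (Ici 0) t := by
  have h1 : ∀ α, HasDerivWithinAt
      (fun s => P.expect ω N s ((P.mOp N α - algebraMap ℂ (QuasiLocal d) (m s α)) ^ 2))
      (P.evolvedState ω N t (varianceDeriv
        ⟨N, hN, m t, hmem t ht, P.evolvedState ω N t, P.isState_evolvedState ω hN ht⟩ α))
      (Ici 0) t := fun α => by
    have hd : ∀ O, HasDerivWithinAt (fun s => P.expect ω N s O)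
        (P.expect ω N t (P.lindblad N O)) (Ici 0) t := fun O =>
      (P.hasDerivAt_expect ω N O t).hasDerivWithinAt
    have hmα := hm.2 t ht α
    have hL1 : P.lindblad N 1 = 0 := by simp [lindblad_apply]
    -- After expanding the square, time enters through expectations of the fixed operators `m²`,
    -- `m`, `1` and scalar coefficients, so the scalar product rule suffices.
    have h2 := ((hd (P.mOp N α ^ 2)).sub ((hmα.const_mul 2).mul (hd (P.mOp N α)))).add
      ((hmα.pow 2).mul (hd 1))
    have e : ∀ s (O : QuasiLocal d), P.expect ω N s O = P.evolvedState ω N s O := fun _ _ => rfl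
    refine (h2.congr_deriv ?_).congr_of_eventuallyEq ?_ ?_
    · have h1 := P.expect_one ω hN ht
      rw [e] at h1
      simp only [varianceDeriv, sq_sub_smul_one, map_sub, map_add, map_smul, hL1, e, h1,
        smul_eq_mul, map_zero, P.meanField_eq_field (hmem t ht)]
      push_cast
      ring
    · refine Eventually.of_forall fun s => ?_
      simp only [Algebra.algebraMap_eq_smul_one, sq_sub_smul_one, e, map_sub, map_add, map_smul,
        smul_eq_mul]
      rfl
    · simp only [Algebra.algebraMap_eq_smul_one, sq_sub_smul_one, e, map_sub, map_add, map_smul,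
        smul_eq_mul]
      rfl
  rw [map_sum]
  exact Complex.reCLM.hasFDerivAt.comp_hasDerivWithinAt t
    (HasDerivWithinAt.fun_sum fun α (_ : α ∈ Finset.univ) => h1 α)

lemma totalVariance_nonneg (ω : QState d) (m : ℝ → Fin (d ^ 2) → ℝ) {N : ℕ} (hN : 1 ≤ N)
    {t : ℝ} (ht : 0 ≤ t) : 0 ≤ P.totalVariance ω m N t := by
  rw [totalVariance_eq]
  refine Finset.sum_nonneg fun α _ => (P.isState_evolvedState ω hN ht).pos.sq_re_nonneg ?_
  rw [IsSelfAdjoint, star_sub, (P.isSelfAdjoint_mOp _ _).star_eq, star_smul, star_one,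
    Complex.star_def, Complex.conj_ofReal]

/-- Cauchy–Schwarz; this turns vanishing variance into convergence of expectations. -/
lemma sq_norm_expect_sub_le (ω : QState d) (m : ℝ → Fin (d ^ 2) → ℝ) {N : ℕ} (hN : 1 ≤ N)
    {t : ℝ} (ht : 0 ≤ t) (α : Fin (d ^ 2)) :
    ‖P.expect ω N t (P.mOp N α) - m t α‖ ^ 2 ≤ P.totalVariance ω m N t := by
  have hs := P.isState_evolvedState ω hN ht
  have hsa : ∀ β, IsSelfAdjoint (P.mOp N β - (m t β : ℂ) • 1) := fun β => by
    rw [IsSelfAdjoint, star_sub, (P.isSelfAdjoint_mOp _ _).star_eq, star_smul, star_one,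
      Complex.star_def, Complex.conj_ofReal]
  have h1 := hs.sq_norm_apply_le (P.mOp N α - (m t α : ℂ) • 1)
  have h2 : P.evolvedState ω N t (P.mOp N α - (m t α : ℂ) • 1) =
      P.expect ω N t (P.mOp N α) - m t α := by
    have := P.expect_one ω hN ht
    rw [← evolvedState_apply] at this ⊢
    rw [map_sub, map_smul, this, smul_eq_mul, mul_one]
  rw [(hsa α).star_eq, ← sq, ContinuousLinearMap.coe_coe, h2] at h1
  rw [totalVariance_eq]
  exact h1.trans (Finset.single_le_sum
    (f := fun β => (P.evolvedState ω N t ((P.mOp N β - (m t β : ℂ) • 1) ^ 2)).re)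
    (fun β _ => hs.pos.sq_re_nonneg (hsa β)) (Finset.mem_univ α))

/-- Propagation of chaos for the averages, with constants depending only on the model. -/
theorem exists_totalVariance_le :
    ∃ C₁ C₂ : ℝ, 0 < C₁ ∧ 0 < C₂ ∧
      ∀ (ω : QState d) (m₀ : Fin (d ^ 2) → ℝ),
        (∀ α, Filter.Tendsto (fun N : ℕ => ω.toLin (P.mOp N α)) Filter.atTop
          (nhds (m₀ α : ℂ))) →
        ∃ m : ℝ → Fin (d ^ 2) → ℝ,
          P.IsMeanFieldSolution m₀ m ∧
          (∀ m', P.IsMeanFieldSolution m₀ m' → Set.EqOn m' m (Set.Ici 0)) ∧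
          (∀ N : ℕ, 1 ≤ N → ∀ t : ℝ, 0 ≤ t →
            P.totalVariance ω m N t ≤
              Real.exp (C₁ * t) * P.totalVariance ω m N 0 +
                C₂ * (Real.exp (C₁ * t) - 1) / (C₁ * N)) ∧
          (Filter.Tendsto (fun N : ℕ => P.totalVariance ω m N 0) Filter.atTop (nhds 0) →
            ∀ t : ℝ, 0 ≤ t →
              Filter.Tendsto (fun N : ℕ => P.totalVariance ω m N t) Filter.atTop (nhds 0) ∧
              ∀ α, Filter.Tendsto (fun N : ℕ => P.expect ω N t (P.mOp N α)) Filter.atTop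
                (nhds (m t α : ℂ))) := by
  obtain ⟨C, hC, hbound⟩ := P.exists_varianceDeriv_le
  -- The constants coincide because the derivative is bounded by `C` times the sum of the variance
  -- and `1/N`.
  refine ⟨C, C, hC, hC, fun ω m₀ hlim => ?_⟩
  obtain ⟨m, hm, hmem⟩ := P.exists_solution (P.mem_stateSet_of_tendsto hlim)
  have hgron : ∀ N : ℕ, 1 ≤ N → ∀ t : ℝ, 0 ≤ t → P.totalVariance ω m N t ≤
      Real.exp (C * t) * P.totalVariance ω m N 0 + C * (Real.exp (C * t) - 1) / (C * N) := by
    intro N hN t ht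
    have hd : ∀ (s : ℝ) (hs : 0 ≤ s), _ := fun s hs =>
      P.hasDerivWithinAt_totalVariance ω hm hmem hN hs
    -- The derivative is expressed through a `Config`, which requires a nonnegative time; the
    -- default `0` is never met on `[0, t]`.
    let f' : ℝ → ℝ := fun s => if hs : 0 ≤ s then
      (P.evolvedState ω N s (∑ α, Model.varianceDeriv
        ⟨N, hN, m s, hmem s hs, P.evolvedState ω N s, P.isState_evolvedState ω hN hs⟩ α)).re
      else 0
    have hf' : ∀ (s : ℝ) (hs : 0 ≤ s), f' s = (P.evolvedState ω N s (∑ α, Model.varianceDeriv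
        ⟨N, hN, m s, hmem s hs, P.evolvedState ω N s, P.isState_evolvedState ω hN hs⟩ α)).re :=
      fun s hs => dif_pos hs
    have := le_gronwallBound_of_liminf_deriv_right_le (f := P.totalVariance ω m N) (f' := f')
      (δ := P.totalVariance ω m N 0) (K := C) (ε := C * (N : ℝ)⁻¹) (a := 0) (b := t)
      (fun s hs => (hd s hs.1).continuousWithinAt.mono Icc_subset_Ici_self)
      (fun s hs r hr => by
        rw [hf' s hs.1] at hr
        exact ((hd s hs.1).mono (Ici_subset_Ici.2 hs.1)).liminf_right_slope_le hr)
      le_rfl (fun s hs => by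
        rw [hf' s hs.1, ← mul_add, P.totalVariance_eq]
        exact hbound ⟨N, hN, m s, hmem s hs.1, P.evolvedState ω N s,
          P.isState_evolvedState ω hN hs.1⟩) t ⟨ht, le_rfl⟩
    rw [gronwallBound_of_K_ne_0 hC.ne', sub_zero] at this
    refine this.trans (le_of_eq ?_)
    have hN0 : (N : ℝ) ≠ 0 := by exact_mod_cast (by lia : N ≠ 0)
    field_simp
  refine ⟨m, hm, fun m' hm' => P.eqOn_of_isMeanFieldSolution hm hm', hgron, fun h0 t ht => ?_⟩
  -- The `C` in the denominator is separated from `N` so that the upper bound is a constant times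
  -- `1/N`.
  have hvar : Tendsto (fun N : ℕ => P.totalVariance ω m N t) atTop (𝓝 0) := by
    have hup : Tendsto (fun N : ℕ => Real.exp (C * t) * P.totalVariance ω m N 0 +
        C * (Real.exp (C * t) - 1) / C * (N : ℝ)⁻¹) atTop (𝓝 0) := by
      simpa using (h0.const_mul (Real.exp (C * t))).add
        ((tendsto_inv_atTop_nhds_zero_nat (𝕜 := ℝ)).const_mul
          (C * (Real.exp (C * t) - 1) / C))
    refine squeeze_zero' ?_ ?_ hup
    · filter_upwards [eventually_ge_atTop 1] with N hN
      exact P.totalVariance_nonneg ω m hN ht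
    · filter_upwards [eventually_ge_atTop 1] with N hN
      rw [← div_eq_mul_inv, div_div]
      exact hgron N hN t ht
  refine ⟨hvar, fun α => ?_⟩
  rw [tendsto_iff_norm_sub_tendsto_zero]
  have hsqrt := hvar.sqrt
  rw [Real.sqrt_zero] at hsqrt
  refine squeeze_zero' (Eventually.of_forall fun _ => norm_nonneg _) ?_ hsqrt
  filter_upwards [eventually_ge_atTop 1] with N hN
  exact Real.le_sqrt_of_sq_le (P.sq_norm_expect_sub_le ω m hN ht α)

end Model

end MeanField

end

theorem theorem1 {d q : ℕ} (P : MeanField.Model d q) :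
    ∃ C₁ C₂ : ℝ, 0 < C₁ ∧ 0 < C₂ ∧
      ∀ (ω : MeanField.QState d) (m₀ : Fin (d ^ 2) → ℝ),
        (∀ α, Filter.Tendsto (fun N : ℕ => ω.toLin (P.mOp N α)) Filter.atTop
          (nhds (m₀ α : ℂ))) →
        ∃ m : ℝ → Fin (d ^ 2) → ℝ,
          P.IsMeanFieldSolution m₀ m ∧
          (∀ m', P.IsMeanFieldSolution m₀ m' → Set.EqOn m' m (Set.Ici 0)) ∧
          (∀ N : ℕ, 1 ≤ N → ∀ t : ℝ, 0 ≤ t →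
            P.totalVariance ω m N t ≤
              Real.exp (C₁ * t) * P.totalVariance ω m N 0 +
                C₂ * (Real.exp (C₁ * t) - 1) / (C₁ * N)) ∧
          (Filter.Tendsto (fun N : ℕ => P.totalVariance ω m N 0) Filter.atTop (nhds 0) →
            ∀ t : ℝ, 0 ≤ t →
              Filter.Tendsto (fun N : ℕ => P.totalVariance ω m N t) Filter.atTop (nhds 0) ∧
              ∀ α, Filter.Tendsto (fun N : ℕ => P.expect ω N t (P.mOp N α)) Filter.atTop
                (nhds (m t α : ℂ))) :=
  P.exists_totalVariance_le
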